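/- Let $d\ge 1$, $0\le\alpha\le 1$ and $0<\gamma<d$. Consider one of the following two settings. *Continuous setting.* $\Omega\subset\mathbb R^d$ is open, $X=\Omega$ with Lebesgue measure, and $H$ is a Schrödinger operator $-\Delta+V$ with Dirichlet boundary conditions on $\partial\Omega$: $V$ is a real measurable function and $H$ is a self-adjoint operator on $L^2(\Omega)$ such that for every $f$ in its domain $Vf\in L^1_{\rm loc}(\Omega)$, $Hf=-\Delta f+Vf$ in the sense of distributions on $\Omega$, and $\chi f\in H^1_0(\Omega)$ for every $\chi\in C_c^\infty(\mathbb R^d)$. *Discrete setting.* $\Omega\subset\mathbb Z^d$ is infinite and connected (for nearest neighbours), $X=\Omega$ with counting measure, $v:\Omega\to\mathbb R$ is arbitrary, and $H=h_v^\Omega$ is the operator $(Hf)(n)=\sum_{|k-n|=1,\,k\in\Omega}f(k)+v(n)f(n)$ on $\{f\in\ell^2(\Omega): Hf\in\ell^2(\Omega)\}$. Let $\psi\in L^2(X)$. Let $\mu^\psi$ be the spectral measure of $H$ at $\psi$, that is, $\int (E-z)^{-1}\,d\mu^\psi(E)=((H-z)^{-1}\psi,\psi)$ for $z\in\mathbb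 C\setminus\mathbb R$; let $\mathcal H_\psi$ be the cyclic subspace generated by $\psi$ and $H$; and let $U_\psi:\mathcal H_\psi\to L^2(\mathbb R,d\mu^\psi)$ be the unitary map with $U_\psi\psi=1$ that turns $H|_{\mathcal H_\psi}$ into multiplication by $E$. Extend $U_\psi$ by $0$ to $\mathcal H_\psi^\perp$. Suppose that $U_\psi$ is an integral operator with a measurable kernel $u(x,E)$ (the generalized eigenfunctions corresponding to $\psi$): for every $\varphi\in L^2(X)$ of bounded support, $(U_\psi\varphi)(E)=\int_X u(x,E)\varphi(x)\,dx$ for $\mu^\psi$-a.e. $E$, where the integrand is integrable and in the discrete setting the integral is a sum. Suppose there is a Borel set $S\subset\mathbb R$ with $\mu^\psi(S)>0$ such that the restriction of $\mu^\psi$ to $S$ is $\alpha$-continuous (it gives zero weight to all sets of zero $\alpha$-dimensional Hausdorff measure) and, for all $E\in S$, $$\limsup_{R\to\infty}R^{-\gamma}\,\|u(\cdot,E)\|_{B_R}^2<\infty ,\qquad \|f\|_{B_R}^2=\int_{X\cap\{|x|<R\}}|f(x)|^2\,dx .$$ Put $$\langle\langle |X|^m\rangle\rangle_T=\frac1T\int_0^T\int_X|x|^m\,\bigl|(e^{-iHt}\psi)(x)\bigr|^2\,dx\,dt\in[0,\infty].$$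 Then for every $m>0$: (a) in the continuous setting, and in the discrete setting whenever $\psi$ does not vanish identically off the origin, there is a constant $C_m>0$ such that $\langle\langle |X|^m\rangle\rangle_T\ge C_m\,T^{m\alpha/\gamma}$ for all $T>0$; (b) in the discrete setting, for every $\psi$ as above (including multiples of $\delta_0$) and every $T_0>0$, there is a constant $C_m>0$ such that $\langle\langle |X|^m\rangle\rangle_T\ge C_m\,T^{m\alpha/\gamma}$ for all $T\ge T_0$. -/

import Mathlib

open MeasureTheory Filter Topology
open scoped ENNReal ContDiff InnerProductSpace

noncomputable section

/-! ### Spectral measure, cyclic subspace, spectral representation and evolution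
of an (unbounded) operator on a complex Hilbert space -/

section Abstract

variable {𝓗 : Type*} [NormedAddCommGroup 𝓗] [InnerProductSpace ℂ 𝓗]

/-- `μ` is the spectral measure of `H` at `φ`: the finite Borel measure on `ℝ` with
`((H - z)⁻¹ φ, φ) = ∫ (E - z)⁻¹ dμ(E)` for all non-real `z`. (The inner product of Mathlib is
conjugate-linear in the first slot.) A finite measure is determined by these integrals. -/
def IsSpectralMeasure (H : 𝓗 →ₗ.[ℂ] 𝓗) (φ : 𝓗) (μ : Measure ℝ) : Prop :=
  IsFiniteMeasure μ ∧ ∀ z : ℂ, z.im ≠ 0 →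
    ∃ f : H.domain, H f - z • (f : 𝓗) = φ ∧ ⟪φ, (f : 𝓗)⟫_ℂ = ∫ E : ℝ, ((E : ℂ) - z)⁻¹ ∂μ

open Classical in
/-- The spectral measure `μ^φ` of `H` (it exists whenever `H` is self-adjoint; the value is `0`
for an operator that has none). -/
def spectralMeasure (H : 𝓗 →ₗ.[ℂ] 𝓗) (φ : 𝓗) : Measure ℝ :=
  if h : ∃ μ, IsSpectralMeasure H φ μ then h.choose else 0

instance spectralMeasure_isFiniteMeasure (H : 𝓗 →ₗ.[ℂ] 𝓗) (φ : 𝓗) :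
    IsFiniteMeasure (spectralMeasure H φ) := by
  unfold spectralMeasure
  split_ifs with h
  · exact h.choose_spec.1
  · infer_instance

/-- The cyclic subspace `𝓗_ψ` generated by `ψ` and `H`: the closed linear span of the vectors
`(H - z)⁻¹ ψ`, `z` non-real. -/
abbrev cyclicSubspace (H : 𝓗 →ₗ.[ℂ] 𝓗) (ψ : 𝓗) : Submodule ℂ 𝓗 :=
  (Submodule.span ℂ
    {φ : 𝓗 | ∃ z : ℂ, z.im ≠ 0 ∧ ∃ f : H.domain, H f - z • (f : 𝓗) = ψ ∧ (f : 𝓗) = φ}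
    ).topologicalClosure

/-- `U` is the unitary map `U_ψ : 𝓗_ψ → L²(ℝ, dμ^ψ)` that sends `ψ` to the function `1` and
realizes `U_ψ H U_ψ⁻¹ = ` multiplication by `E` (equality of operators, domains included). -/
structure IsSpectralRepresentation (H : 𝓗 →ₗ.[ℂ] 𝓗) (ψ : 𝓗)
    (U : cyclicSubspace H ψ ≃ₗᵢ[ℂ] Lp ℂ 2 (spectralMeasure H ψ)) : Prop where
  map_one : (U.symm (Lp.const 2 (spectralMeasure H ψ) (1 : ℂ)) : 𝓗) = ψ
  mem_domain_iff : ∀ φ : cyclicSubspace H ψ,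
    (φ : 𝓗) ∈ H.domain ↔ MemLp (fun E : ℝ => (E : ℂ) * U φ E) 2 (spectralMeasure H ψ)
  map_apply : ∀ (φ : cyclicSubspace H ψ) (hφ : (φ : 𝓗) ∈ H.domain),
    ∃ h : H ⟨(φ : 𝓗), hφ⟩ ∈ cyclicSubspace H ψ,
      U ⟨H ⟨(φ : 𝓗), hφ⟩, h⟩ =ᵐ[spectralMeasure H ψ] fun E : ℝ => (E : ℂ) * U φ E

/-- `φ : ℝ → 𝓗` solves the Schrödinger equation `i ∂ₜ φ = H φ`, `φ 0 = ψ`, in the weak sense: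
`φ` is continuous and `d/dt (φ(t), η) = -i (φ(t), H η)` for every `η` in the domain of `H`. -/
def IsSchrodingerSolution (H : 𝓗 →ₗ.[ℂ] 𝓗) (ψ : 𝓗) (φ : ℝ → 𝓗) : Prop :=
  Continuous φ ∧ φ 0 = ψ ∧ ∀ (η : H.domain) (t : ℝ),
    HasDerivAt (fun s => ⟪(η : 𝓗), φ s⟫_ℂ) (-Complex.I * ⟪H η, φ t⟫_ℂ) t

open Classical in
/-- The evolution `t ↦ exp(-i H t) ψ`: for self-adjoint `H` it is the one and only weak solution of
the Schrödinger equation with initial state `ψ` (the value is `0` where there is none). -/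
def evolution (H : 𝓗 →ₗ.[ℂ] 𝓗) (ψ : 𝓗) : ℝ → 𝓗 :=
  if h : ∃ φ, IsSchrodingerSolution H ψ φ then h.choose else 0

end Abstract

/-- A Borel measure on `ℝ` is `α`-continuous if it gives zero weight to every set of zero
`α`-dimensional Hausdorff measure. -/
def IsAlphaContinuous (α : ℝ) (μ : Measure ℝ) : Prop :=
  ∀ A : Set ℝ, Measure.hausdorffMeasure α A = 0 → μ A = 0

/-! ### Generalized eigenfunctions and moments in `L²(X, ν)`, where `ρ x` is the length `|x|` -/

section Position

variable {X : Type*} [MeasurableSpace X]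

/-- `u(x, E)` are the generalized eigenfunctions corresponding to `ψ`: the unitary map
`U_ψ : 𝓗_ψ → L²(ℝ, dμ^ψ)`, extended by `0` to the orthogonal complement of `𝓗_ψ`, is the integral
operator with kernel `u`, i.e. `(U_ψ φ)(E) = ∫ u(x, E) φ(x) dν(x)` for all `φ ∈ L²` of bounded
support and `μ^ψ`-almost every `E`. -/
def AreGeneralizedEigenfunctions (ν : Measure X) (ρ : X → ℝ) (H : Lp ℂ 2 ν →ₗ.[ℂ] Lp ℂ 2 ν)
    (ψ : Lp ℂ 2 ν) (u : X → ℝ → ℂ) : Prop :=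
  AEStronglyMeasurable (Function.uncurry u) (ν.prod (spectralMeasure H ψ)) ∧
  ∃ U : cyclicSubspace H ψ ≃ₗᵢ[ℂ] Lp ℂ 2 (spectralMeasure H ψ),
    IsSpectralRepresentation H ψ U ∧
    ∀ (φ : Lp ℂ 2 ν) (R : ℝ), (∀ᵐ x ∂ν, R ≤ ρ x → φ x = 0) →
      ∀ᵐ E ∂(spectralMeasure H ψ), Integrable (fun x => u x E * φ x) ν ∧
        U ((cyclicSubspace H ψ).orthogonalProjectionOnto φ) E = ∫ x, u x E * φ x ∂ν

/-- `‖f‖²_{B_R}`, the squared `L²` norm of `f` over the ball `B_R = {|x| < R}`. -/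
def sqNormBall (ν : Measure X) (ρ : X → ℝ) (f : X → ℂ) (R : ℝ) : ℝ≥0∞ :=
  ∫⁻ x in {x | ρ x < R}, ‖f x‖ₑ ^ 2 ∂ν

/-- The growth condition `limsup_{R → ∞} R^{-γ} ‖f‖²_{B_R} < ∞`. -/
def HasGrowth (ν : Measure X) (ρ : X → ℝ) (γ : ℝ) (f : X → ℂ) : Prop :=
  limsup (fun R : ℝ => ENNReal.ofReal (R ^ (-γ)) * sqNormBall ν ρ f R) atTop < ⊤

/-- The time-averaged moment
`⟨⟨|X|^m⟩⟩_T = (1/T) ∫₀ᵀ ∫ |x|^m |(exp(-iHt)ψ)(x)|² dν(x) dt`, with values in `[0, ∞]`. -/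
def averagedMoment (ν : Measure X) (ρ : X → ℝ) (H : Lp ℂ 2 ν →ₗ.[ℂ] Lp ℂ 2 ν)
    (ψ : Lp ℂ 2 ν) (m T : ℝ) : ℝ≥0∞ :=
  ENNReal.ofReal (1 / T) *
    ∫⁻ t in Set.Ioc 0 T, ∫⁻ x, ENNReal.ofReal (ρ x ^ m) * ‖evolution H ψ t x‖ₑ ^ 2 ∂ν

end Position

/-! ### Continuous Schrödinger operators -/

section ContinuousSetting

variable {d : ℕ}

/-- `φ ∈ C_c^∞(Ω)`. -/
def IsTestFunction (Ω : Set (EuclideanSpace ℝ (Fin d))) (φ : EuclideanSpace ℝ (Fin d) → ℂ) :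
    Prop :=
  ContDiff ℝ (∞ : ℕ∞ω) φ ∧ HasCompactSupport φ ∧ tsupport φ ⊆ Ω

/-- `f ∈ H¹₀(Ω)`, the closure of `C_c^∞(Ω)` in the Sobolev norm of `W^1_2`. -/
def MemH10 (Ω : Set (EuclideanSpace ℝ (Fin d))) (f : EuclideanSpace ℝ (Fin d) → ℂ) : Prop :=
  MemLp f 2 (volume.restrict Ω) ∧
  ∃ G : EuclideanSpace ℝ (Fin d) → (EuclideanSpace ℝ (Fin d) →L[ℝ] ℂ),
    MemLp G 2 (volume.restrict Ω) ∧
    ∃ φ : ℕ → EuclideanSpace ℝ (Fin d) → ℂ, (∀ n, IsTestFunction Ω (φ n)) ∧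
      Tendsto (fun n => eLpNorm (φ n - f) 2 (volume.restrict Ω)) atTop (𝓝 0) ∧
      Tendsto (fun n => eLpNorm (fderiv ℝ (φ n) - G) 2 (volume.restrict Ω)) atTop (𝓝 0)

/-- `H` is a Schrödinger operator `-Δ + V` on `L²(Ω)` with Dirichlet boundary conditions: a
self-adjoint operator such that every `f` in its domain lies in `H¹₀(Ω)` locally up to the boundary
(`χ f ∈ H¹₀(Ω)` for every cutoff `χ ∈ C_c^∞(ℝ^d)`) and `H f = -Δ f + V f` in the sense of
distributions on `Ω`. -/
def IsDirichletSchrodinger (Ω : Set (EuclideanSpace ℝ (Fin d)))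
    (V : EuclideanSpace ℝ (Fin d) → ℝ)
    (H : Lp ℂ 2 (volume.restrict Ω) →ₗ.[ℂ] Lp ℂ 2 (volume.restrict Ω)) : Prop :=
  IsSelfAdjoint H ∧ ∀ f : H.domain,
    (∀ χ : EuclideanSpace ℝ (Fin d) → ℂ, IsTestFunction Set.univ χ →
      MemH10 Ω (fun x => χ x * (f : Lp ℂ 2 (volume.restrict Ω)) x)) ∧
    LocallyIntegrableOn (fun x => (V x : ℂ) * (f : Lp ℂ 2 (volume.restrict Ω)) x) Ω ∧
    ∀ φ : EuclideanSpace ℝ (Fin d) → ℂ, IsTestFunction Ω φ →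
      ∫ x in Ω, ((f : Lp ℂ 2 (volume.restrict Ω)) x * (-Laplacian.laplacian φ x)
        + (V x : ℂ) * (f : Lp ℂ 2 (volume.restrict Ω)) x * φ x) = ∫ x in Ω, H f x * φ x

end ContinuousSetting

/-! ### Discrete Schrödinger operators -/

section DiscreteSetting

variable {d : ℕ}

/-- The Euclidean length `|n|` of `n ∈ ℤ^d`. -/
def latticeNorm (n : Fin d → ℤ) : ℝ := Real.sqrt (∑ i, (n i : ℝ) ^ 2)

lemma latticeNorm_sub_comm (n k : Fin d → ℤ) : latticeNorm (n - k) = latticeNorm (k - n) := by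
  unfold latticeNorm
  congr 1
  refine Finset.sum_congr rfl fun i _ => ?_
  simp only [Pi.sub_apply]
  push_cast
  ring

/-- The nearest-neighbour graph of `ℤ^d`: `n` and `k` are adjacent if `|n - k| = 1`. -/
def latticeGraph (d : ℕ) : SimpleGraph (Fin d → ℤ) where
  Adj n k := latticeNorm (n - k) = 1
  symm := ⟨fun n k h => by rw [latticeNorm_sub_comm]; exact h⟩
  loopless := ⟨fun n h => by simp [latticeNorm] at h⟩

lemma finite_neighbors (Ω : Set (Fin d → ℤ)) (n : Ω) :
    {k : Ω | (latticeGraph d).Adj n k}.Finite := by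
  have hfin : (Set.Icc ((n : Fin d → ℤ) - 1) ((n : Fin d → ℤ) + 1)).Finite := Set.finite_Icc _ _
  refine (hfin.preimage (f := ((↑) : Ω → (Fin d → ℤ))) Subtype.val_injective.injOn).subset ?_
  intro k hk
  have hk : (latticeGraph d).Adj n k := hk
  have hk' : latticeNorm ((n : Fin d → ℤ) - (k : Fin d → ℤ)) = 1 := hk
  have hsum : ∑ i, (((n : Fin d → ℤ) - (k : Fin d → ℤ)) i : ℝ) ^ 2 = 1 := by
    unfold latticeNorm at hk'
    simpa using hk'
  have hi : ∀ i, -1 ≤ (n : Fin d → ℤ) i - (k : Fin d → ℤ) i ∧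
      (n : Fin d → ℤ) i - (k : Fin d → ℤ) i ≤ 1 := by
    intro i
    have h1 : (((n : Fin d → ℤ) - (k : Fin d → ℤ)) i : ℝ) ^ 2 ≤ 1 := by
      rw [← hsum]
      exact Finset.single_le_sum (f := fun i => (((n : Fin d → ℤ) - (k : Fin d → ℤ)) i : ℝ) ^ 2)
        (fun j _ => sq_nonneg _) (Finset.mem_univ i)
    have h2 : (((n : Fin d → ℤ) - (k : Fin d → ℤ)) i) ^ 2 ≤ 1 := by exact_mod_cast h1
    simp only [Pi.sub_apply] at h2
    constructor <;> nlinarith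
  simp only [Set.mem_preimage, Set.mem_Icc, Pi.le_def, Pi.sub_apply, Pi.add_apply, Pi.one_apply]
  exact ⟨fun i => by have := hi i; omega, fun i => by have := hi i; omega⟩

/-- The difference expression `(h f)(n) = ∑_{|k-n|=1, k ∈ Ω} f(k) + v(n) f(n)`
(a finite sum for each `n`). -/
def discreteExpr (Ω : Set (Fin d → ℤ)) (v : Ω → ℝ) (f : Ω → ℂ) (n : Ω) : ℂ :=
  (∑ᶠ k ∈ {k : Ω | (latticeGraph d).Adj n k}, f k) + (v n : ℂ) * f n

lemma discreteExpr_add (Ω : Set (Fin d → ℤ)) (v : Ω → ℝ) (f g : Ω → ℂ) :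
    discreteExpr Ω v (f + g) = discreteExpr Ω v f + discreteExpr Ω v g := by
  funext n
  simp only [discreteExpr, Pi.add_apply]
  rw [finsum_mem_add_distrib (finite_neighbors Ω n)]
  ring

lemma discreteExpr_smul (Ω : Set (Fin d → ℤ)) (v : Ω → ℝ) (c : ℂ) (f : Ω → ℂ) :
    discreteExpr Ω v (c • f) = c • discreteExpr Ω v f := by
  funext n
  simp only [discreteExpr, Pi.smul_apply, smul_eq_mul]
  have h := (AddMonoidHom.mulLeft c).map_finsum_mem f (finite_neighbors Ω n)
  simp only [AddMonoidHom.coe_mulLeft] at h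
  rw [mul_add, h]
  ring

lemma coeFn_add_count (Ω : Set (Fin d → ℤ)) (f g : Lp ℂ 2 (Measure.count : Measure Ω)) :
    (⇑(f + g) : Ω → ℂ) = ⇑f + ⇑g :=
  funext (Measure.ae_count_iff.1 (Lp.coeFn_add f g))

lemma coeFn_smul_count (Ω : Set (Fin d → ℤ)) (c : ℂ) (f : Lp ℂ 2 (Measure.count : Measure Ω)) :
    (⇑(c • f) : Ω → ℂ) = c • ⇑f :=
  funext (Measure.ae_count_iff.1 (Lp.coeFn_smul c f))

/-- The discrete Schrödinger operator `h_v^Ω` on `ℓ²(Ω)`, `Ω ⊂ ℤ^d`, with Dirichlet boundary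
conditions, on its natural domain `{f ∈ ℓ²(Ω) : h f ∈ ℓ²(Ω)}`. -/
def discreteSchrodinger (Ω : Set (Fin d → ℤ)) (v : Ω → ℝ) :
    Lp ℂ 2 (Measure.count : Measure Ω) →ₗ.[ℂ] Lp ℂ 2 (Measure.count : Measure Ω) where
  domain :=
    { carrier := {f | MemLp (discreteExpr Ω v f) 2 (Measure.count : Measure Ω)}
      add_mem' := by
        intro f g hf hg
        simp only [Set.mem_ofPred_eq] at hf hg ⊢
        rw [coeFn_add_count, discreteExpr_add]
        exact hf.add hg
      zero_mem' := by
        have h := coeFn_smul_count Ω 0 0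
        simp only [Set.mem_ofPred_eq]
        rw [← zero_smul ℂ (0 : Lp ℂ 2 (Measure.count : Measure Ω)), h, discreteExpr_smul,
          zero_smul]
        exact MemLp.zero
      smul_mem' := by
        intro c f hf
        simp only [Set.mem_ofPred_eq] at hf ⊢
        rw [coeFn_smul_count, discreteExpr_smul]
        exact hf.const_smul c }
  toFun :=
    { toFun := fun f => MemLp.toLp (discreteExpr Ω v (f : Lp ℂ 2 (Measure.count : Measure Ω))) f.2
      map_add' := fun f g => by
        have h : discreteExpr Ω v ⇑((f : Lp ℂ 2 (Measure.count : Measure Ω)) + g) =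
            discreteExpr Ω v ⇑(f : Lp ℂ 2 (Measure.count : Measure Ω)) +
              discreteExpr Ω v ⇑(g : Lp ℂ 2 (Measure.count : Measure Ω)) := by
          rw [coeFn_add_count, discreteExpr_add]
        exact (MemLp.toLp_congr _ (f.2.add g.2) (Eventually.of_forall (congrFun h))).trans
          (MemLp.toLp_add f.2 g.2)
      map_smul' := fun c f => by
        have h : discreteExpr Ω v ⇑(c • (f : Lp ℂ 2 (Measure.count : Measure Ω))) =
            c • discreteExpr Ω v ⇑(f : Lp ℂ 2 (Measure.count : Measure Ω)) := by
          rw [coeFn_smul_count, discreteExpr_smul]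
        exact (MemLp.toLp_congr _ (f.2.const_smul c) (Eventually.of_forall (congrFun h))).trans
          (MemLp.toLp_const_smul c f.2) }

end DiscreteSetting

end

/-! Write `μ` for the spectral measure of `ψ`. Since `S` has positive measure, countable exhaustion
yields `S' ⊂ S` with `μ S' > 0` on which the hypotheses are uniform: `μ` restricted to `S'` gives
every ball of radius `r` centred in `S'` mass at most `N r^α`, and the eigenfunctions satisfy
`‖u(·,E)‖²_{B_n} ≤ N n^γ` for all integers `n ≥ N` (`exists_uniform_subset`). The Hölder half is the
density theorem of Rogers and Taylor: the points without a Hölder constant form a set of zero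
`α`-dimensional Hausdorff measure (`hausdorffMeasure_compl_holderSet`).

Split `e^{-iHt}ψ` orthogonally into its spectral parts over `S'` and over the complement. At a fixed
point `x` the first part is `∫_{S'} e^{-iEt} conj u(x,E) dμ(E)` (`spectral_part_eq_integral`), the
Fourier transform of an `L²` density against a uniformly Hölder measure. Strichartz' estimate
(`lintegral_sq_integral_phase_le`) bounds the time average of its squared modulus by a constant
times `T^{-α} ∫_{S'} |u(x,E)|² dμ(E)`. Integration over `|x| < R` shows that the average mass of
this part in the ball is `O(T^{-α} R^γ)`. With `R^γ = δ T^α` and `δ` small, it mostly lives outside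
the ball, and by orthogonality the complementary part cannot cancel that mass
(`half_norm_sq_le_lintegral_compl`). So the whole state keeps a fixed average mass outside `B_R`,
and the moment is at least a constant times `R^m`, that is, times `T^{mα/γ}`.

This works for `α > 0` and large `T`. Bounded times use continuity of the evolution and some mass
off the origin at one instant. For `α = 0` a constant lower bound is needed: in the continuous
setting a small ball around the null set `{0}` carries little eigenfunction mass; in the discrete
setting hopping to a neighbour prevents the state from staying at the origin
(`IsSchrodingerSolution.hopping_bound`). -/

noncomputable section

/-! ### Weak solutions of the Schrödinger equation -/

section AbstractEvolution

variable {𝓗 : Type*} [NormedAddCommGroup 𝓗] [InnerProductSpace ℂ 𝓗]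

/-- `H` is symmetric and its domain contains the domain of its adjoint (density of the domain is not
required). -/
def IsSymmetricMaximal (H : 𝓗 →ₗ.[ℂ] 𝓗) : Prop :=
  (∀ f g : H.domain, ⟪H f, (g : 𝓗)⟫_ℂ = ⟪(f : 𝓗), H g⟫_ℂ) ∧
  ∀ g h : 𝓗, (∀ η : H.domain, ⟪H η, g⟫_ℂ = ⟪(η : 𝓗), h⟫_ℂ) →
    ∃ hg : g ∈ H.domain, H ⟨g, hg⟩ = h

lemma IsSelfAdjoint.isSymmetricMaximal [CompleteSpace 𝓗] {H : 𝓗 →ₗ.[ℂ] 𝓗}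
    (hH : IsSelfAdjoint H) : IsSymmetricMaximal H := by
  have hd := hH.dense_domain
  have hadj : H.adjoint = H := LinearPMap.isSelfAdjoint_def.1 hH
  have hformal := LinearPMap.adjoint_isFormalAdjoint hd
  rw [hadj] at hformal
  refine ⟨fun f g => hformal f g, fun g h hgh => ?_⟩
  have hg : g ∈ H.adjoint.domain := by
    refine LinearPMap.mem_adjoint_domain_of_exists g ⟨h, fun x => ?_⟩
    rw [← inner_conj_symm, ← hgh, inner_conj_symm]
  have hval : H.adjoint ⟨g, hg⟩ = h := by
    refine LinearPMap.adjoint_apply_eq hd ⟨g, hg⟩ fun x => ?_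
    rw [← inner_conj_symm, ← hgh, inner_conj_symm]
  have key : ∀ K : 𝓗 →ₗ.[ℂ] 𝓗, K = H → ∀ hg : g ∈ K.domain, K ⟨g, hg⟩ = h →
      ∃ hg : g ∈ H.domain, H ⟨g, hg⟩ = h := by
    rintro K rfl hg e
    exact ⟨hg, e⟩
  exact key _ hadj hg hval

/-- The difference `δ` of two solutions need not lie in the domain, but its integral `Φ` does:
integrating the weak equation and using maximality gives `H Φ = i δ`. By symmetry `⟪Φ, H Φ⟫` is
real, so `‖Φ‖²` has zero derivative; hence `Φ = 0` and `δ = Φ' = 0`. -/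
lemma IsSchrodingerSolution.eq [CompleteSpace 𝓗] {H : 𝓗 →ₗ.[ℂ] 𝓗}
    (hH : IsSymmetricMaximal H) {ψ : 𝓗} {φ₁ φ₂ : ℝ → 𝓗}
    (h₁ : IsSchrodingerSolution H ψ φ₁) (h₂ : IsSchrodingerSolution H ψ φ₂) : φ₁ = φ₂ := by
  set δ : ℝ → 𝓗 := fun t => φ₁ t - φ₂ t with hδ
  have hδc : Continuous δ := h₁.1.sub h₂.1
  have hδ0 : δ 0 = 0 := by simp [hδ, h₁.2.1, h₂.2.1]
  have hδd : ∀ (η : H.domain) (t : ℝ),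
      HasDerivAt (fun s => ⟪(η : 𝓗), δ s⟫_ℂ) (-Complex.I * ⟪H η, δ t⟫_ℂ) t := by
    intro η t
    have := (h₁.2.2 η t).sub (h₂.2.2 η t)
    simp only [hδ, inner_sub_right, mul_sub]
    exact this
  set Φ : ℝ → 𝓗 := fun t => ∫ s in (0 : ℝ)..t, δ s with hΦ
  have hΦd : ∀ t, HasDerivAt Φ (δ t) t := fun t =>
    intervalIntegral.integral_hasDerivAt_right (hδc.intervalIntegrable _ _)
      hδc.aestronglyMeasurable.stronglyMeasurableAtFilter hδc.continuousAt
  have hHΦ : ∀ t, ∃ h : Φ t ∈ H.domain, H ⟨Φ t, h⟩ = Complex.I • δ t := by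
    intro t
    refine hH.2 _ _ fun η => ?_
    have hc : Continuous fun s => -Complex.I * ⟪H η, δ s⟫_ℂ :=
      continuous_const.mul (continuous_const.inner hδc)
    have e1 := intervalIntegral.integral_eq_sub_of_hasDerivAt
      (fun s _ => hδd η s) (hc.intervalIntegrable 0 t)
    have e2 : ∫ s in (0 : ℝ)..t, ⟪H η, δ s⟫_ℂ = ⟪H η, Φ t⟫_ℂ :=
      (innerSL ℂ (H η)).intervalIntegral_comp_comm (hδc.intervalIntegrable 0 t)
    rw [intervalIntegral.integral_const_mul, e2, hδ0, inner_zero_right, sub_zero] at e1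
    rw [inner_smul_right, ← e1, ← mul_assoc]
    simp
  have hnorm : ∀ t, HasDerivAt (fun s => ⟪Φ s, Φ s⟫_ℂ) 0 t := by
    intro t
    obtain ⟨hmem, he⟩ := hHΦ t
    have hsym := hH.1 ⟨Φ t, hmem⟩ ⟨Φ t, hmem⟩
    simp only [he, inner_smul_left, inner_smul_right, Complex.conj_I] at hsym
    have h := (hΦd t).inner ℂ (hΦd t)
    have h0 : Complex.I * (⟪Φ t, δ t⟫_ℂ + ⟪δ t, Φ t⟫_ℂ) = 0 := by linear_combination -hsym
    rwa [(mul_eq_zero.1 h0).resolve_left Complex.I_ne_zero] at h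
  have hΦ0 : ∀ t, Φ t = 0 := by
    intro t
    have hc := is_const_of_deriv_eq_zero (fun s => (hnorm s).differentiableAt)
      (fun s => (hnorm s).deriv) t 0
    have h0 : Φ 0 = 0 := by simp [hΦ]
    simpa [h0] using hc
  funext t
  have h0 : HasDerivAt Φ 0 t := by
    have : Φ = fun _ => 0 := funext hΦ0
    rw [this]
    exact hasDerivAt_const t 0
  exact sub_eq_zero.1 ((hΦd t).unique h0)

/-- `evolution` is picked by choice, so uniqueness is what allows it to be computed from any
explicit solution. -/
lemma evolution_eq [CompleteSpace 𝓗] {H : 𝓗 →ₗ.[ℂ] 𝓗} (hH : IsSymmetricMaximal H) {ψ : 𝓗}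
    {φ : ℝ → 𝓗} (hφ : IsSchrodingerSolution H ψ φ) : evolution H ψ = φ := by
  have h : ∃ φ, IsSchrodingerSolution H ψ φ := ⟨φ, hφ⟩
  rw [evolution, dif_pos h]
  exact h.choose_spec.eq hH hφ

end AbstractEvolution

/-! ### The evolution in the spectral representation -/

/-- The function `e^{-iEt}`. -/
def phase (t E : ℝ) : ℂ := Complex.exp (-(E * t : ℝ) * Complex.I)

@[simp] lemma norm_phase (t E : ℝ) : ‖phase t E‖ = 1 := by
  rw [phase, ← Complex.ofReal_neg]
  exact Complex.norm_exp_ofReal_mul_I _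

@[simp] lemma phase_zero (E : ℝ) : phase 0 E = 1 := by simp [phase]

lemma continuous_uncurry_phase : Continuous (Function.uncurry phase) := by
  unfold phase Function.uncurry
  fun_prop

lemma continuous_phase (t : ℝ) : Continuous (phase t) := by
  unfold phase
  fun_prop

lemma hasDerivAt_phase (t E : ℝ) : HasDerivAt (fun s => phase s E) (-Complex.I * E * phase t E) t := by
  have h1 : HasDerivAt (fun s : ℝ => (-(E * s : ℝ) : ℂ) * Complex.I) (-(E : ℂ) * Complex.I) t := by
    have := ((hasDerivAt_id t).ofReal_comp.const_mul (-(E : ℂ))).mul_const Complex.I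
    simpa using this
  have h2 := h1.cexp
  unfold phase
  convert h2 using 1
  ring

lemma memLp_phase (μ : Measure ℝ) [IsFiniteMeasure μ] {A : Set ℝ} (hA : MeasurableSet A) (t : ℝ) :
    MemLp (A.indicator (phase t)) 2 μ := by
  refine (MemLp.of_bound (continuous_phase t).aestronglyMeasurable 1 ?_).indicator hA
  exact Eventually.of_forall fun E => (norm_phase t E).le

/-- The element `χ_A e^{-iEt}` of `L²(μ)`. -/
def phaseLp (μ : Measure ℝ) [IsFiniteMeasure μ] (A : Set ℝ) (hA : MeasurableSet A) (t : ℝ) :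
    Lp ℂ 2 μ := (memLp_phase μ hA t).toLp _

lemma coeFn_phaseLp (μ : Measure ℝ) [IsFiniteMeasure μ] (A : Set ℝ) (hA : MeasurableSet A) (t : ℝ) :
    phaseLp μ A hA t =ᵐ[μ] A.indicator (phase t) := MemLp.coeFn_toLp _

lemma phaseLp_add_compl (μ : Measure ℝ) [IsFiniteMeasure μ] (A : Set ℝ) (hA : MeasurableSet A)
    (t : ℝ) : phaseLp μ A hA t + phaseLp μ Aᶜ hA.compl t = phaseLp μ Set.univ .univ t := by
  refine Lp.ext ?_
  filter_upwards [Lp.coeFn_add (phaseLp μ A hA t) (phaseLp μ Aᶜ hA.compl t),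
    coeFn_phaseLp μ A hA t, coeFn_phaseLp μ Aᶜ hA.compl t, coeFn_phaseLp μ .univ .univ t]
    with E h1 h2 h3 h4
  rw [h1, h4, Pi.add_apply, h2, h3, Set.indicator_univ]
  exact Set.indicator_self_add_compl_apply A _ E

lemma norm_sq_eq_integral {X : Type*} [MeasurableSpace X] {ν : Measure X} (f : Lp ℂ 2 ν) :
    ‖f‖ ^ 2 = ∫ x, ‖f x‖ ^ 2 ∂ν := by
  have h1 : ⟪f, f⟫_ℂ = (‖f‖ : ℂ) ^ 2 := inner_self_eq_norm_sq_to_K f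
  have h2 : ⟪f, f⟫_ℂ = ∫ x, ((‖f x‖ ^ 2 : ℝ) : ℂ) ∂ν := by
    rw [L2.inner_def]
    refine integral_congr_ae (Eventually.of_forall fun x => ?_)
    simp [inner_self_eq_norm_sq_to_K]
  rw [h1, integral_complex_ofReal] at h2
  exact_mod_cast h2

lemma norm_phaseLp_sq (μ : Measure ℝ) [IsFiniteMeasure μ] (A : Set ℝ) (hA : MeasurableSet A)
    (t : ℝ) : ‖phaseLp μ A hA t‖ ^ 2 = μ.real A := by
  have : ∀ᵐ E ∂μ, ‖phaseLp μ A hA t E‖ ^ 2 = A.indicator (fun _ => (1 : ℝ)) E := by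
    filter_upwards [coeFn_phaseLp μ A hA t] with E hE
    rw [hE]
    by_cases hEA : E ∈ A <;> simp [hEA]
  rw [norm_sq_eq_integral, integral_congr_ae this, integral_indicator hA]
  simp

lemma continuous_phaseLp (μ : Measure ℝ) [IsFiniteMeasure μ] (A : Set ℝ) (hA : MeasurableSet A) :
    Continuous (phaseLp μ A hA) := by
  rw [continuous_iff_continuousAt]
  intro t
  have hint : ∀ s, ‖phaseLp μ A hA s - phaseLp μ A hA t‖ ^ 2
      = ∫ E in A, ‖phase s E - phase t E‖ ^ 2 ∂μ := by
    intro s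
    rw [norm_sq_eq_integral, ← integral_indicator hA]
    refine integral_congr_ae ?_
    filter_upwards [Lp.coeFn_sub (phaseLp μ A hA s) (phaseLp μ A hA t), coeFn_phaseLp μ A hA s,
      coeFn_phaseLp μ A hA t] with E h1 h2 h3
    rw [h1, Pi.sub_apply, h2, h3]
    by_cases hEA : E ∈ A <;> simp [hEA]
  have hcont : Continuous fun s => ∫ E in A, ‖phase s E - phase t E‖ ^ 2 ∂μ := by
    refine continuous_of_dominated (bound := fun _ => 4) (fun s => ?_) (fun s => ?_)
      (integrable_const _) (Eventually.of_forall fun E => ?_)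
    · exact (((continuous_phase s).sub (continuous_phase t)).norm.pow 2).aestronglyMeasurable
    · refine Eventually.of_forall fun E => ?_
      have : ‖phase s E - phase t E‖ ≤ 2 := (norm_sub_le _ _).trans (by norm_num)
      rw [Real.norm_of_nonneg (by positivity)]
      nlinarith [norm_nonneg (phase s E - phase t E)]
    · have : Continuous fun s => phase s E :=
        continuous_uncurry_phase.comp (Continuous.prodMk_left E)
      fun_prop
  have h0 : Tendsto (fun s => ‖phaseLp μ A hA s - phaseLp μ A hA t‖ ^ 2) (𝓝 t) (𝓝 0) := by
    have := hcont.tendsto t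
    simp only [sub_self, norm_zero, ne_eq, OfNat.ofNat_ne_zero, not_false_eq_true, zero_pow,
      integral_zero] at this
    simpa only [hint] using this
  rw [ContinuousAt, tendsto_iff_norm_sub_tendsto_zero]
  have h1 := h0.sqrt
  simpa [Real.sqrt_sq] using h1

section Cyclic

variable {𝓗 : Type*} [NormedAddCommGroup 𝓗] [InnerProductSpace ℂ 𝓗] [CompleteSpace 𝓗]
  {H : 𝓗 →ₗ.[ℂ] 𝓗} {ψ : 𝓗}
  {U : cyclicSubspace H ψ ≃ₗᵢ[ℂ] Lp ℂ 2 (spectralMeasure H ψ)}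

lemma inner_spectralRepresentation_symm (η : 𝓗) (g : Lp ℂ 2 (spectralMeasure H ψ)) :
    ⟪η, (U.symm g : 𝓗)⟫_ℂ =
      ∫ E, g E * starRingEnd ℂ (U ((cyclicSubspace H ψ).orthogonalProjectionOnto η) E)
        ∂(spectralMeasure H ψ) := by
  rw [← Submodule.inner_orthogonalProjectionOnto_eq_of_mem_right, ← U.inner_map_map,
    U.apply_symm_apply, L2.inner_def]
  simp only [RCLike.inner_apply]

/-- The cyclic subspace reduces `H`: the projection of `H η` is represented by `E` times the
representation of the projection of `η`. -/
lemma IsSpectralRepresentation.map_projection (hU : IsSpectralRepresentation H ψ U)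
    (hH : IsSymmetricMaximal H) (η : H.domain) :
    U ((cyclicSubspace H ψ).orthogonalProjectionOnto (H η)) =ᵐ[spectralMeasure H ψ]
      fun E : ℝ => (E : ℂ) * U ((cyclicSubspace H ψ).orthogonalProjectionOnto (η : 𝓗)) E := by
  set h := U ((cyclicSubspace H ψ).orthogonalProjectionOnto (H η)) with hh
  set f := U ((cyclicSubspace H ψ).orthogonalProjectionOnto (η : 𝓗)) with hf
  have hbd : ∀ (n : ℕ) (q : Lp ℂ 2 (spectralMeasure H ψ)),
      MemLp ((Set.Icc (-(n : ℝ)) n).indicator fun E : ℝ => (E : ℂ) * q E) 2 (spectralMeasure H ψ) := by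
    intro n q
    have hm : AEStronglyMeasurable (fun E : ℝ => (E : ℂ) * q E) (spectralMeasure H ψ) :=
      Complex.continuous_ofReal.aestronglyMeasurable.mul (Lp.aestronglyMeasurable q)
    refine MemLp.of_le_mul (c := n) (Lp.memLp q) (hm.indicator measurableSet_Icc)
      (Eventually.of_forall fun E => ?_)
    by_cases hE : E ∈ Set.Icc (-(n : ℝ)) n
    · rw [Set.indicator_of_mem hE, norm_mul, Complex.norm_real, Real.norm_eq_abs]
      exact mul_le_mul_of_nonneg_right (abs_le.2 hE) (norm_nonneg _)
    · rw [Set.indicator_of_notMem hE, norm_zero]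
      positivity
  -- Cutting off to `|E| ≤ n` makes `g = χ_I (h - E f)` the representative of a vector in the
  -- domain. Symmetry of `H` between `η` and this vector gives `∫ g conj h = ∫ E g conj f`, that is,
  -- `∫ |g|² = 0`.
  have key : ∀ n : ℕ, ∀ᵐ E ∂(spectralMeasure H ψ), E ∈ Set.Icc (-(n : ℝ)) n → h E = (E : ℂ) * f E := by
    intro n
    set I := Set.Icc (-(n : ℝ)) n with hI
    have hIm : MeasurableSet I := measurableSet_Icc
    have hg1 : MemLp (I.indicator fun E : ℝ => h E - (E : ℂ) * f E) 2 (spectralMeasure H ψ) := by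
      have := ((Lp.memLp h).indicator hIm).sub (hbd n f)
      rwa [← Set.indicator_sub'] at this
    set g : Lp ℂ 2 (spectralMeasure H ψ) := hg1.toLp _ with hg
    have hgc : g =ᵐ[spectralMeasure H ψ] I.indicator fun E : ℝ => h E - (E : ℂ) * f E := hg1.coeFn_toLp
    have hEg : (fun E : ℝ => (E : ℂ) * g E) =ᵐ[spectralMeasure H ψ] I.indicator fun E : ℝ => (E : ℂ) * g E := by
      filter_upwards [hgc] with E hE
      by_cases hEI : E ∈ I <;> simp [hEI, hE]
    have hgdom : ((U.symm g : cyclicSubspace H ψ) : 𝓗) ∈ H.domain := by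
      rw [hU.mem_domain_iff, U.apply_symm_apply]
      exact (hbd n g).ae_eq hEg.symm
    obtain ⟨hc, hmul⟩ := hU.map_apply (U.symm g) hgdom
    set k := U ⟨H ⟨((U.symm g : cyclicSubspace H ψ) : 𝓗), hgdom⟩, hc⟩ with hk
    rw [U.apply_symm_apply] at hmul
    have hsym := hH.1 η ⟨((U.symm g : cyclicSubspace H ψ) : 𝓗), hgdom⟩
    rw [inner_spectralRepresentation_symm] at hsym
    have hksymm : H ⟨((U.symm g : cyclicSubspace H ψ) : 𝓗), hgdom⟩ = (U.symm k : 𝓗) := by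
      rw [hk, U.symm_apply_apply]
    rw [hksymm, inner_spectralRepresentation_symm] at hsym
    have hnorm : ∫ E, ‖g E‖ ^ 2 ∂(spectralMeasure H ψ) = 0 := by
      have hi1 : Integrable (fun E => g E * starRingEnd ℂ (h E)) (spectralMeasure H ψ) := by
        simpa only [RCLike.inner_apply] using L2.integrable_inner (𝕜 := ℂ) h g
      have hi2 : Integrable (fun E => k E * starRingEnd ℂ (f E)) (spectralMeasure H ψ) := by
        simpa only [RCLike.inner_apply] using L2.integrable_inner (𝕜 := ℂ) f k
      have h3 := sub_eq_zero.2 hsym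
      rw [← integral_sub hi1 hi2] at h3
      have h4 : ∫ E, ((‖g E‖ ^ 2 : ℝ) : ℂ) ∂(spectralMeasure H ψ) = 0 := by
        rw [← h3]
        refine integral_congr_ae ?_
        filter_upwards [hgc, hmul] with E hE hkE
        rw [hkE]
        by_cases hEI : E ∈ I
        · rw [hE, Set.indicator_of_mem hEI, Complex.ofReal_pow, ← Complex.mul_conj']
          simp only [map_sub, map_mul, Complex.conj_ofReal]
          ring
        · simp [hE, hEI]
      rw [integral_complex_ofReal] at h4
      exact_mod_cast h4
    rw [integral_eq_zero_iff_of_nonneg (fun E => by positivity)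
      ((Lp.memLp g).integrable_norm_pow two_ne_zero)] at hnorm
    filter_upwards [hnorm, hgc] with E h1 h2 hEI
    simp only [Pi.zero_apply, ne_eq, OfNat.ofNat_ne_zero, not_false_eq_true, pow_eq_zero_iff,
      norm_eq_zero] at h1
    rw [h1, Set.indicator_of_mem hEI] at h2
    exact sub_eq_zero.1 h2.symm
  filter_upwards [ae_all_iff.2 key] with E hE
  obtain ⟨n, hn⟩ := exists_nat_ge |E|
  exact hE n (abs_le.1 hn)

/-- The weak equation is differentiation of `∫ e^{-iEt} conj f dμ` under the integral sign. The
dominating function `|E| ‖f E‖` is integrable because `E f` represents the projection of `H η`, by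
`map_projection`. -/
lemma IsSpectralRepresentation.isSchrodingerSolution_symm_phaseLp
    (hU : IsSpectralRepresentation H ψ U) (hH : IsSymmetricMaximal H) :
    IsSchrodingerSolution H ψ
      (fun t => (U.symm (phaseLp (spectralMeasure H ψ) Set.univ .univ t) : 𝓗)) := by
  refine ⟨?_, ?_, fun η t => ?_⟩
  · exact continuous_subtype_val.comp (U.symm.continuous.comp (continuous_phaseLp (spectralMeasure H ψ) _ _))
  · refine Eq.trans ?_ hU.map_one
    dsimp only
    congr 2
    refine Lp.ext ?_
    filter_upwards [coeFn_phaseLp (spectralMeasure H ψ) .univ .univ 0, Lp.coeFn_const (p := 2) (μ := spectralMeasure H ψ) (1 : ℂ)]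
      with E h1 h2
    rw [h1, h2]
    simp
  · set f := U ((cyclicSubspace H ψ).orthogonalProjectionOnto (η : 𝓗)) with hf
    have hproj := hU.map_projection hH η
    set h := U ((cyclicSubspace H ψ).orthogonalProjectionOnto (H η)) with hh
    have e1 : ∀ (q : Lp ℂ 2 (spectralMeasure H ψ)) (s : ℝ), ∫ E, phaseLp (spectralMeasure H ψ) Set.univ .univ s E * starRingEnd ℂ (q E) ∂(spectralMeasure H ψ)
        = ∫ E, phase s E * starRingEnd ℂ (q E) ∂(spectralMeasure H ψ) := by
      intro q s
      refine integral_congr_ae ?_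
      filter_upwards [coeFn_phaseLp (spectralMeasure H ψ) .univ .univ s] with E hE
      rw [hE, Set.indicator_univ]
    have hq : ∀ (q : Lp ℂ 2 (spectralMeasure H ψ)), Integrable (fun E => starRingEnd ℂ (q E)) (spectralMeasure H ψ) := fun q => by
      exact (Lp.memLp q).star.integrable one_le_two
    have hEf : Integrable (fun E : ℝ => |E| * ‖f E‖) (spectralMeasure H ψ) := by
      refine ((Lp.memLp h).integrable one_le_two).norm.congr ?_
      filter_upwards [hproj] with E hE
      rw [hE, norm_mul, Complex.norm_real, Real.norm_eq_abs]
    have hm : ∀ s, AEStronglyMeasurable (fun E => phase s E * starRingEnd ℂ (f E))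
        (spectralMeasure H ψ) :=
      fun s => (continuous_phase s).aestronglyMeasurable.mul (hq f).aestronglyMeasurable
    have hD := (hasDerivAt_integral_of_dominated_loc_of_deriv_le (μ := spectralMeasure H ψ)
      (F := fun s E => phase s E * starRingEnd ℂ (f E))
      (F' := fun s E => -Complex.I * E * phase s E * starRingEnd ℂ (f E)) (x₀ := t)
      (bound := fun E => |E| * ‖f E‖) (s := Set.univ) univ_mem (Eventually.of_forall hm)
      ((hq f).mono (hm t) (Eventually.of_forall fun E => by simp))
      (by
        have : Continuous fun E : ℝ => -Complex.I * E * phase t E :=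
          (continuous_const.mul Complex.continuous_ofReal).mul (continuous_phase t)
        exact this.aestronglyMeasurable.mul (hq f).aestronglyMeasurable)
      (Eventually.of_forall fun E s _ => by simp)
      hEf (Eventually.of_forall fun E s _ => (hasDerivAt_phase s E).mul_const _)).2
    simp only [inner_spectralRepresentation_symm, ← hf, ← hh, e1]
    refine hD.congr_deriv ?_
    rw [← integral_const_mul]
    refine integral_congr_ae ?_
    filter_upwards [hproj] with E hE
    rw [hE, map_mul, Complex.conj_ofReal]
    ring

/-- In the spectral representation the evolution is multiplication by `e^{-iEt}`. -/
lemma IsSpectralRepresentation.evolution_eq (hU : IsSpectralRepresentation H ψ U)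
    (hH : IsSymmetricMaximal H) : evolution H ψ =
      fun t => (U.symm (phaseLp (spectralMeasure H ψ) Set.univ .univ t) : 𝓗) :=
  _root_.evolution_eq hH (hU.isSchrodingerSolution_symm_phaseLp hH)

lemma IsSpectralRepresentation.isSchrodingerSolution_evolution
    (hU : IsSpectralRepresentation H ψ U) (hH : IsSymmetricMaximal H) :
    IsSchrodingerSolution H ψ (evolution H ψ) := by
  rw [hU.evolution_eq hH]
  exact hU.isSchrodingerSolution_symm_phaseLp hH

lemma IsSpectralRepresentation.norm_evolution_sq (hU : IsSpectralRepresentation H ψ U)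
    (hH : IsSymmetricMaximal H) (t : ℝ) :
    ‖evolution H ψ t‖ ^ 2 = (spectralMeasure H ψ).real Set.univ := by
  simp only [hU.evolution_eq hH]
  rw [Submodule.norm_coe, U.symm.norm_map, norm_phaseLp_sq]

end Cyclic

/-! ### Decomposition of `α`-continuous measures -/

section Hausdorff

/-- The points at which `μ` is `α`-Hölder continuous with constant `N`. -/
def holderSet (α : ℝ) (μ : Measure ℝ) (N : ℕ) : Set ℝ :=
  {x | ∀ r : ℝ, 0 < r → μ (Metric.ball x r) ≤ ENNReal.ofReal (N * r ^ α)}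

/-- Violation of the Hölder bound is an open condition: by continuity from below a slightly smaller
ball already violates it, and balls of the original radius about nearby centres contain that smaller
ball. Closedness is used for measurability. -/
lemma isClosed_holderSet (α : ℝ) (μ : Measure ℝ) (N : ℕ) : IsClosed (holderSet α μ N) := by
  rw [← isOpen_compl_iff, Metric.isOpen_iff]
  intro x hx
  simp only [holderSet, Set.mem_compl_iff, Set.mem_ofPred_eq, not_forall, not_le] at hx
  obtain ⟨r, hr, hxr⟩ := hx
  have hU : Metric.ball x r = ⋃ n : ℕ, Metric.ball x (r - 1 / (n + 1)) := by
    ext y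
    simp only [Metric.mem_ball, Set.mem_iUnion]
    constructor
    · intro hy
      obtain ⟨n, hn⟩ := exists_nat_one_div_lt (sub_pos.2 hy)
      exact ⟨n, by linarith⟩
    · rintro ⟨n, hn⟩
      have : (0 : ℝ) < 1 / (n + 1) := by positivity
      linarith
  have hmono : Monotone fun n : ℕ => Metric.ball x (r - 1 / ((n : ℝ) + 1)) := by
    intro n k hnk
    refine Metric.ball_subset_ball ?_
    have : (1 : ℝ) / (k + 1) ≤ 1 / (n + 1) := Nat.one_div_le_one_div hnk
    linarith
  rw [hU, hmono.measure_iUnion, lt_iSup_iff] at hxr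
  obtain ⟨n, hn⟩ := hxr
  refine ⟨1 / (n + 1), by positivity, fun y hy => ?_⟩
  simp only [holderSet, Set.mem_compl_iff, Set.mem_ofPred_eq, not_forall, not_le]
  refine ⟨r, hr, hn.trans_le (measure_mono fun z hz => ?_)⟩
  simp only [Metric.mem_ball] at hz hy ⊢
  have := dist_triangle z x y
  rw [dist_comm] at hy
  linarith

lemma holderSet_mono (α : ℝ) (μ : Measure ℝ) : Monotone (holderSet α μ) := by
  intro N M hNM x hx r hr
  refine (hx r hr).trans (ENNReal.ofReal_le_ofReal ?_)
  have : (N : ℝ) ≤ M := by exact_mod_cast hNM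
  gcongr

/-- At every point of `A` and for every `N` some ball satisfies `(N + 1) r^α < μ(ball)`. A disjoint
Vitali subfamily, enlarged five times, covers `A`, and its sum of `diam^α` is at most `10^α/(N + 1)`
times the total mass, which tends to zero. -/
lemma hausdorffMeasure_compl_holderSet {α : ℝ} (hα : 0 ≤ α) (μ : Measure ℝ) [IsFiniteMeasure μ] :
    Measure.hausdorffMeasure α (⋂ N, (holderSet α μ N)ᶜ) = 0 := by
  set A := ⋂ N, (holderSet α μ N)ᶜ with hA
  set M := μ.real Set.univ with hM
  have hM0 : 0 ≤ M := measureReal_nonneg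
  have hex : ∀ (N : ℕ) (x : ℝ), x ∈ A →
      ∃ r : ℝ, 0 < r ∧ ENNReal.ofReal ((N + 1 : ℕ) * r ^ α) < μ (Metric.ball x r) := by
    intro N x hx
    have := Set.mem_iInter.1 hx (N + 1)
    simpa only [holderSet, Set.mem_compl_iff, Set.mem_ofPred_eq, not_forall, not_le,
      exists_prop] using this
  have hpow : ∀ (N : ℕ) (x r : ℝ), 0 < r →
      ENNReal.ofReal ((N + 1 : ℕ) * r ^ α) < μ (Metric.ball x r) → r ^ α < M / (N + 1 : ℕ) := by
    intro N x r hr h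
    have h1 := h.trans_le (measure_mono (Set.subset_univ _))
    rw [← ofReal_measureReal, ENNReal.ofReal_lt_ofReal_iff_of_nonneg (by positivity)] at h1
    rw [lt_div_iff₀ (by positivity)]
    linarith
  rcases hα.eq_or_lt with h0 | hpos
  -- For `α = 0` the density condition reads `N + 1 < μ(ball)`, impossible once `N` exceeds the
  -- total mass.
  · have : A = ∅ := by
      rw [Set.eq_empty_iff_forall_notMem]
      intro x hx
      obtain ⟨N, hN⟩ := exists_nat_ge M
      obtain ⟨r, hr, hr'⟩ := hex N x hx
      have h1 := hpow N x r hr hr'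
      rw [← h0, Real.rpow_zero, lt_div_iff₀ (by positivity)] at h1
      push_cast at h1
      linarith
    rw [this, measure_empty]
  choose! r hr0 hr using hex
  -- Finiteness of `μ` bounds the selected radii uniformly. This supplies the radius bound in
  -- Vitali's lemma and makes the diameters of the covers tend to zero.
  set R : ℕ → ℝ := fun N => (M / (N + 1 : ℕ)) ^ α⁻¹ with hR
  have hrR : ∀ N, ∀ x ∈ A, r N x ≤ R N := by
    intro N x hx
    have h1 := (hpow N x _ (hr0 N x hx) (hr N x hx)).le
    rwa [hR, Real.le_rpow_inv_iff_of_pos (hr0 N x hx).le (by positivity) hpos]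
  have hvit := fun N => Vitali.exists_disjoint_subfamily_covering_enlargement_closedBall
    A id (r N) (R N) (hrR N) 5 (by norm_num)
  choose u huA hud hu using hvit
  have hcount : ∀ N, Countable (u N) := by
    intro N
    refine (Set.PairwiseDisjoint.countable_of_nonempty_interior (hud N) fun x hx => ?_).to_subtype
    exact ⟨x, Metric.ball_subset_interior_closedBall
      (Metric.mem_ball_self (hr0 N x (huA N hx)))⟩
  have hRlim : Tendsto R atTop (𝓝 0) := by
    have h1 : Tendsto (fun N : ℕ => M / ((N + 1 : ℕ) : ℝ)) atTop (𝓝 0) :=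
      (tendsto_const_div_atTop_nhds_zero_nat M).comp (tendsto_add_atTop_nat 1)
    have h2 := h1.rpow_const (p := α⁻¹) (Or.inr (inv_nonneg.2 hα))
    rwa [Real.zero_rpow (inv_ne_zero hpos.ne')] at h2
  have hdiam : ∀ (N : ℕ) (x : ℝ), x ∈ A →
      Metric.ediam (Metric.closedBall (id x) (5 * r N x)) ≤ ENNReal.ofReal (10 * r N x) := by
    intro N x hx
    have h5 : 0 ≤ 5 * r N x := by linarith [hr0 N x hx]
    rw [← Metric.closedEBall_ofReal h5]
    refine Metric.ediam_closedEBall_le.trans ?_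
    rw [← ENNReal.ofReal_ofNat 2, ← ENNReal.ofReal_mul (by norm_num)]
    refine ENNReal.ofReal_le_ofReal ?_
    linarith
  have hle := Measure.hausdorffMeasure_le_liminf_tsum α A (l := atTop)
    (fun N => ENNReal.ofReal (10 * R N))
    (by
      have := ENNReal.tendsto_ofReal (hRlim.const_mul 10)
      simpa using this)
    (fun N (i : u N) => Metric.closedBall (id i.1) (5 * r N i.1))
    (Eventually.of_forall fun N i => (hdiam N i.1 (huA N i.2)).trans
      (ENNReal.ofReal_le_ofReal (by linarith [hrR N i.1 (huA N i.2)])))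
    (Eventually.of_forall fun N x hx => by
      obtain ⟨b, hb, hxb⟩ := hu N x hx
      exact Set.mem_iUnion.2 ⟨⟨b, hb⟩, hxb (Metric.mem_closedBall_self (hr0 N x hx).le)⟩)
  have hsum : ∀ N, ∑' i : u N, Metric.ediam (Metric.closedBall (id i.1) (5 * r N i.1)) ^ α
      ≤ ENNReal.ofReal (10 ^ α * (M / (N + 1 : ℕ))) := by
    intro N
    have := hcount N
    have hterm : ∀ i : u N, Metric.ediam (Metric.closedBall (id i.1) (5 * r N i.1)) ^ α ≤
        ENNReal.ofReal (10 ^ α / (N + 1 : ℕ)) * μ (Metric.closedBall (id i.1) (r N i.1)) := by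
      intro i
      have hi := huA N i.2
      have hri := hr0 N _ hi
      calc Metric.ediam (Metric.closedBall (id i.1) (5 * r N i.1)) ^ α
          ≤ ENNReal.ofReal (10 * r N i.1) ^ α := ENNReal.rpow_le_rpow (hdiam N _ hi) hα
        _ = ENNReal.ofReal (10 ^ α / (N + 1 : ℕ)) * ENNReal.ofReal ((N + 1 : ℕ) * r N i.1 ^ α) := by
            rw [ENNReal.ofReal_rpow_of_pos (by linarith), ← ENNReal.ofReal_mul (by positivity),
              Real.mul_rpow (by norm_num) hri.le]
            congr 1
            have : ((N + 1 : ℕ) : ℝ) ≠ 0 := by positivity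
            field_simp
        _ ≤ _ := by
            gcongr
            exact (hr N _ hi).le.trans (measure_mono Metric.ball_subset_closedBall)
    calc _ ≤ ∑' i : u N, ENNReal.ofReal (10 ^ α / (N + 1 : ℕ)) *
          μ (Metric.closedBall (id i.1) (r N i.1)) := ENNReal.tsum_le_tsum hterm
      _ = ENNReal.ofReal (10 ^ α / (N + 1 : ℕ)) *
          μ (⋃ i : u N, Metric.closedBall (id i.1) (r N i.1)) := by
          rw [ENNReal.tsum_mul_left, measure_iUnion]
          · intro i j hij
            exact hud N i.2 j.2 (Subtype.coe_injective.ne hij)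
          · exact fun i => Metric.isClosed_closedBall.measurableSet
      _ ≤ ENNReal.ofReal (10 ^ α / (N + 1 : ℕ)) * ENNReal.ofReal M := by
          rw [hM, ofReal_measureReal]
          gcongr
          exact Set.subset_univ _
      _ = _ := by
          rw [← ENNReal.ofReal_mul (by positivity)]
          congr 1
          ring
  have hlim : Tendsto (fun N : ℕ => ENNReal.ofReal (10 ^ α * (M / (N + 1 : ℕ)))) atTop (𝓝 0) := by
    have h1 : Tendsto (fun N : ℕ => M / ((N + 1 : ℕ) : ℝ)) atTop (𝓝 0) :=
      (tendsto_const_div_atTop_nhds_zero_nat M).comp (tendsto_add_atTop_nat 1)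
    have := ENNReal.tendsto_ofReal (h1.const_mul (10 ^ α))
    simpa using this
  refine le_antisymm (hle.trans ?_) zero_le
  rw [← hlim.liminf_eq]
  exact liminf_le_liminf (Eventually.of_forall hsum)

end Hausdorff

/-! ### Time averages of Fourier transforms of uniformly Hölder continuous measures -/

section Strichartz

/-- The constant `∑ (k + 1) e^{-k²/4}`. -/
def gaussConst : ℝ≥0∞ := ∑' k : ℕ, ENNReal.ofReal (Real.exp (-(k : ℝ) ^ 2 / 4) * (k + 1))

lemma gaussConst_ne_top : gaussConst ≠ ⊤ := by
  have h0 : Summable fun k : ℕ => Real.exp 1 * (((k : ℝ) ^ 1 * Real.exp (-1 * k))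
      + ((k : ℝ) ^ 0 * Real.exp (-1 * k))) :=
    ((Real.summable_pow_mul_exp_neg_nat_mul 1 one_pos).add
      (Real.summable_pow_mul_exp_neg_nat_mul 0 one_pos)).mul_left _
  have h1 : Summable fun k : ℕ => Real.exp (-(k : ℝ) ^ 2 / 4) * (k + 1) := by
    refine Summable.of_nonneg_of_le (fun k => by positivity) (fun k => ?_) h0
    -- `(k/2 - 1)² ≥ 0` says `-k²/4 ≤ 1 - k`.
    have : Real.exp (-(k : ℝ) ^ 2 / 4) ≤ Real.exp 1 * Real.exp (-1 * k) := by
      rw [← Real.exp_add]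
      refine Real.exp_le_exp.2 ?_
      nlinarith [sq_nonneg ((k : ℝ) / 2 - 1)]
    calc _ ≤ Real.exp 1 * Real.exp (-1 * k) * (k + 1) := by gcongr
      _ = _ := by ring
  exact h1.tsum_ofReal_ne_top

/-- Slice the line by `k = ⌊T|E - E'|⌋`. The slice lies in a ball of radius `(k + 1)/T`, of mass at
most `C ((k + 1)/T)^α ≤ C T^{-α} (k + 1)`, the last step by `α ≤ 1`; the Gaussian weights then sum
to `gaussConst`. -/
lemma lintegral_gaussian_le {α : ℝ} (hα1 : α ≤ 1) (μ : Measure ℝ) {C T : ℝ}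
    (hC : 0 ≤ C) (hT : 0 < T) {E : ℝ}
    (hE : ∀ r : ℝ, 0 < r → μ (Metric.ball E r) ≤ ENNReal.ofReal (C * r ^ α)) :
    ∫⁻ E', ENNReal.ofReal (Real.exp (-(T * (E - E')) ^ 2 / 4)) ∂μ ≤
      ENNReal.ofReal (C * T ^ (-α)) * gaussConst := by
  have hpt : ∀ E', ENNReal.ofReal (Real.exp (-(T * (E - E')) ^ 2 / 4)) ≤
      ∑' k : ℕ, (Metric.ball E ((k + 1) / T)).indicator
        (fun _ => ENNReal.ofReal (Real.exp (-(k : ℝ) ^ 2 / 4))) E' := by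
    intro E'
    set k := ⌊|T * (E - E')|⌋₊ with hk
    have h1 : (k : ℝ) ≤ |T * (E - E')| := Nat.floor_le (abs_nonneg _)
    have h2 : |T * (E - E')| < k + 1 := Nat.lt_floor_add_one _
    refine le_trans ?_ (ENNReal.le_tsum k)
    rw [Set.indicator_of_mem]
    · refine ENNReal.ofReal_le_ofReal (Real.exp_le_exp.2 ?_)
      have : (k : ℝ) ^ 2 ≤ (T * (E - E')) ^ 2 := by
        rw [← sq_abs (T * (E - E'))]
        gcongr
      linarith
    · rw [Metric.mem_ball, dist_comm, Real.dist_eq, lt_div_iff₀ hT]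
      rw [abs_mul, abs_of_pos hT] at h2
      linarith
  refine (lintegral_mono hpt).trans ?_
  rw [lintegral_tsum fun k => (measurable_const.indicator Metric.isOpen_ball.measurableSet).aemeasurable,
    gaussConst, ← ENNReal.tsum_mul_left]
  refine ENNReal.tsum_le_tsum fun k => ?_
  rw [lintegral_indicator Metric.isOpen_ball.measurableSet, lintegral_const,
    Measure.restrict_apply .univ, Set.univ_inter]
  refine (mul_le_mul_right (hE _ (by positivity)) _).trans ?_
  rw [← ENNReal.ofReal_mul (by positivity), ← ENNReal.ofReal_mul (by positivity)]
  refine ENNReal.ofReal_le_ofReal ?_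
  have h3 : ((k : ℝ) + 1) ^ α ≤ k + 1 := by
    calc ((k : ℝ) + 1) ^ α ≤ ((k : ℝ) + 1) ^ (1 : ℝ) :=
          Real.rpow_le_rpow_of_exponent_le (by linarith [k.cast_nonneg (α := ℝ)]) hα1
      _ = _ := Real.rpow_one _
  rw [Real.div_rpow (by positivity) hT.le, Real.rpow_neg hT.le]
  calc Real.exp (-(k : ℝ) ^ 2 / 4) * (C * (((k : ℝ) + 1) ^ α / T ^ α))
      ≤ Real.exp (-(k : ℝ) ^ 2 / 4) * (C * (((k : ℝ) + 1) / T ^ α)) := by gcongr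
    _ = _ := by ring

/-- Schur's test: `f(E) f(E') ≤ (f(E)² + f(E')²)/2`, and for a symmetric kernel the two halves have
equal integrals. -/
lemma lintegral_lintegral_mul_le (μ : Measure ℝ) [SFinite μ] {f : ℝ → ℝ≥0∞} (hf : AEMeasurable f μ)
    {k : ℝ → ℝ → ℝ≥0∞} (hk : Measurable (Function.uncurry k)) (hsymm : ∀ E E', k E E' = k E' E)
    {B : ℝ≥0∞} (hB : ∀ᵐ E ∂μ, ∫⁻ E', k E E' ∂μ ≤ B) :
    ∫⁻ p, f p.1 * f p.2 * k p.1 p.2 ∂(μ.prod μ) ≤ B * ∫⁻ E, f E ^ 2 ∂μ := by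
  have hyoung : ∀ a b : ℝ≥0∞, a * b ≤ a ^ 2 / 2 + b ^ 2 / 2 := by
    intro a b
    have := ENNReal.young_inequality a b Real.HolderConjugate.two_two
    simpa using this
  have hf1 : AEMeasurable (fun p : ℝ × ℝ => f p.1) (μ.prod μ) := hf.comp_fst
  have hk' : AEMeasurable (fun p : ℝ × ℝ => k p.1 p.2) (μ.prod μ) := hk.aemeasurable
  have hk1 : AEMeasurable (fun p : ℝ × ℝ => f p.1 ^ 2 * k p.1 p.2) (μ.prod μ) :=
    (hf1.pow_const 2).mul hk'
  have hswap : ∫⁻ p, f p.2 ^ 2 * k p.1 p.2 ∂(μ.prod μ) = ∫⁻ p, f p.1 ^ 2 * k p.1 p.2 ∂(μ.prod μ) := by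
    rw [← lintegral_prod_swap]
    simp only [Prod.fst_swap, Prod.snd_swap]
    exact lintegral_congr fun p => by rw [hsymm]
  have hmain : ∫⁻ p, f p.1 ^ 2 * k p.1 p.2 ∂(μ.prod μ) ≤ B * ∫⁻ E, f E ^ 2 ∂μ := by
    rw [lintegral_prod _ hk1, ← lintegral_const_mul'' _ (hf.pow_const 2)]
    refine lintegral_mono_ae ?_
    filter_upwards [hB] with E hE
    have hkE : Measurable fun E' => k E E' := hk.comp measurable_prodMk_left
    rw [lintegral_const_mul _ hkE, mul_comm]
    gcongr
  calc ∫⁻ p, f p.1 * f p.2 * k p.1 p.2 ∂(μ.prod μ)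
      ≤ ∫⁻ p, 2⁻¹ * (f p.1 ^ 2 * k p.1 p.2 + f p.2 ^ 2 * k p.1 p.2) ∂(μ.prod μ) := by
        refine lintegral_mono fun p => ?_
        calc f p.1 * f p.2 * k p.1 p.2
            ≤ (f p.1 ^ 2 / 2 + f p.2 ^ 2 / 2) * k p.1 p.2 := by
              gcongr
              exact hyoung _ _
          _ = _ := by
              simp only [div_eq_mul_inv]
              ring
    _ = 2⁻¹ * (∫⁻ p, f p.1 ^ 2 * k p.1 p.2 ∂(μ.prod μ)
          + ∫⁻ p, f p.1 ^ 2 * k p.1 p.2 ∂(μ.prod μ)) := by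
        rw [lintegral_const_mul' _ _ (by simp), lintegral_add_left' hk1, hswap]
    _ = ∫⁻ p, f p.1 ^ 2 * k p.1 p.2 ∂(μ.prod μ) := by
        rw [← two_mul, ← mul_assoc, ENNReal.inv_mul_cancel two_ne_zero ENNReal.ofNat_ne_top, one_mul]
    _ ≤ _ := hmain

lemma integral_gaussian_phase {T : ℝ} (hT : 0 < T) (E E' : ℝ) :
    ∫ t : ℝ, (Real.exp (-(t / T) ^ 2) : ℂ) * (phase t E * starRingEnd ℂ (phase t E')) =
      ((√Real.pi * T * Real.exp (-(T * (E - E')) ^ 2 / 4) : ℝ) : ℂ) := by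
  have hTc : (T : ℂ) ≠ 0 := by exact_mod_cast hT.ne'
  have hb : 0 < ((1 / T ^ 2 : ℝ) : ℂ).re := by
    rw [Complex.ofReal_re]
    positivity
  have h := fourierIntegral_gaussian hb ((E' - E : ℝ) : ℂ)
  have e1 : ∀ t : ℝ, (Real.exp (-(t / T) ^ 2) : ℂ) * (phase t E * starRingEnd ℂ (phase t E')) =
      Complex.exp (Complex.I * ((E' - E : ℝ) : ℂ) * t) *
        Complex.exp (-((1 / T ^ 2 : ℝ) : ℂ) * (t : ℂ) ^ 2) := by
    intro t
    simp only [phase, ← Complex.exp_conj, Complex.ofReal_exp, ← Complex.exp_add]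
    congr 1
    simp only [map_mul, map_neg, Complex.conj_ofReal, Complex.conj_I]
    push_cast
    ring
  simp only [e1]
  rw [h]
  have e2 : ((Real.pi : ℂ) / ((1 / T ^ 2 : ℝ) : ℂ)) ^ (1 / 2 : ℂ) = ((√Real.pi * T : ℝ) : ℂ) := by
    rw [← Complex.ofReal_div, show (1 / 2 : ℂ) = ((1 / 2 : ℝ) : ℂ) by norm_num,
      ← Complex.ofReal_cpow (by positivity), ← Real.sqrt_eq_rpow]
    congr 1
    rw [div_div_eq_mul_div, div_one, Real.sqrt_mul Real.pi_pos.le, Real.sqrt_sq hT.le]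
  rw [e2, Complex.ofReal_mul _ (Real.exp _), Complex.ofReal_exp]
  congr 2
  push_cast
  field_simp
  ring

/-- Strichartz' bound on the time average of the Fourier transform of `f dμ`. -/
lemma lintegral_sq_integral_phase_le (μ : Measure ℝ) [IsFiniteMeasure μ] {f : ℝ → ℂ}
    (hf : MemLp f 2 μ) {T : ℝ} (hT : 0 < T) {B : ℝ≥0∞}
    (hB : ∀ᵐ E ∂μ, ∫⁻ E', ENNReal.ofReal (Real.exp (-(T * (E - E')) ^ 2 / 4)) ∂μ ≤ B) :
    ∫⁻ t in Set.Ioc 0 T, ‖∫ E, phase t E * f E ∂μ‖ₑ ^ 2 ≤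
      ENNReal.ofReal (Real.exp 1 * (√Real.pi * T)) * (B * ∫⁻ E, ‖f E‖ₑ ^ 2 ∂μ) := by
  set F : ℝ → ℂ := fun t => ∫ E, phase t E * f E ∂μ with hF
  set G : ℝ → ℝ := fun t => Real.exp (-(t / T) ^ 2) with hG
  have hG0 : ∀ t, 0 < G t := fun t => Real.exp_pos _
  have hf1 : Integrable f μ := hf.integrable one_le_two
  have hGi : Integrable G := by
    have := integrable_exp_neg_mul_sq (b := 1 / T ^ 2) (by positivity)
    refine this.congr (Eventually.of_forall fun t => ?_)
    simp only [hG]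
    congr 1
    ring
  -- the triple integrand
  set Φ : ℝ × ℝ × ℝ → ℂ := fun q => (G q.1 : ℂ) * ((phase q.1 q.2.1 * f q.2.1) *
    starRingEnd ℂ (phase q.1 q.2.2 * f q.2.2)) with hΦ
  have hff : Integrable (fun p : ℝ × ℝ => f p.1 * starRingEnd ℂ (f p.2)) (μ.prod μ) :=
    hf1.mul_prod (hf.star.integrable one_le_two)
  have hΦi : Integrable Φ (volume.prod (μ.prod μ)) := by
    have h1 : Integrable (fun q : ℝ × ℝ × ℝ => (G q.1 : ℂ) * (f q.2.1 * starRingEnd ℂ (f q.2.2)))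
        (volume.prod (μ.prod μ)) := hGi.ofReal.mul_prod hff
    have h2 : Continuous fun q : ℝ × ℝ × ℝ => phase q.1 q.2.1 * starRingEnd ℂ (phase q.1 q.2.2) := by
      have c1 : Continuous fun q : ℝ × ℝ × ℝ => phase q.1 q.2.1 :=
        continuous_uncurry_phase.comp (by fun_prop : Continuous fun q : ℝ × ℝ × ℝ => (q.1, q.2.1))
      have c2 : Continuous fun q : ℝ × ℝ × ℝ => phase q.1 q.2.2 :=
        continuous_uncurry_phase.comp (by fun_prop : Continuous fun q : ℝ × ℝ × ℝ => (q.1, q.2.2))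
      exact c1.mul (Complex.continuous_conj.comp c2)
    have h3 := h1.bdd_mul (c := 1) h2.aestronglyMeasurable
      (Eventually.of_forall fun q => by simp)
    refine h3.congr (Eventually.of_forall fun q => ?_)
    simp only [hΦ, map_mul]
    ring
  have hinner : ∀ t, ∫ p, Φ (t, p) ∂(μ.prod μ) = ((G t * ‖F t‖ ^ 2 : ℝ) : ℂ) := by
    intro t
    simp only [hΦ]
    rw [integral_const_mul, integral_prod_mul (fun E => phase t E * f E)
      (fun E => starRingEnd ℂ (phase t E * f E)), integral_conj, Complex.mul_conj']
    push_cast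
    rfl
  have houter : ∫ q, Φ q ∂(volume.prod (μ.prod μ)) =
      ∫ p, ((√Real.pi * T * Real.exp (-(T * (p.1 - p.2)) ^ 2 / 4) : ℝ) : ℂ) *
        (f p.1 * starRingEnd ℂ (f p.2)) ∂(μ.prod μ) := by
    rw [integral_prod_symm _ hΦi]
    refine integral_congr_ae (Eventually.of_forall fun p => ?_)
    simp only
    rw [← integral_gaussian_phase hT, ← integral_mul_const]
    refine integral_congr_ae (Eventually.of_forall fun t => ?_)
    simp only [hΦ, hG, map_mul]
    ring
  have hreal : Integrable (fun t => G t * ‖F t‖ ^ 2) := by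
    have := hΦi.integral_prod_left.re
    refine this.congr (Eventually.of_forall fun t => ?_)
    simp only [hinner]
    exact Complex.ofReal_re _
  have hstep : ∫⁻ t, ENNReal.ofReal (G t) * ‖F t‖ₑ ^ 2 ≤
      ENNReal.ofReal (√Real.pi * T) * (B * ∫⁻ E, ‖f E‖ₑ ^ 2 ∂μ) := by
    have e1 : ∀ t, ENNReal.ofReal (G t) * ‖F t‖ₑ ^ 2 = ENNReal.ofReal (G t * ‖F t‖ ^ 2) := by
      intro t
      rw [ENNReal.ofReal_mul (hG0 t).le, ENNReal.ofReal_pow (norm_nonneg _), ofReal_norm]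
    simp only [e1]
    rw [← ofReal_integral_eq_lintegral_ofReal hreal
      (Eventually.of_forall fun t => mul_nonneg (hG0 t).le (sq_nonneg _))]
    have hnn : 0 ≤ ∫ t, G t * ‖F t‖ ^ 2 :=
      integral_nonneg fun t => mul_nonneg (hG0 t).le (sq_nonneg _)
    have e2 : ENNReal.ofReal (∫ t, G t * ‖F t‖ ^ 2) = ‖∫ q, Φ q ∂(volume.prod (μ.prod μ))‖ₑ := by
      rw [integral_prod _ hΦi]
      simp only [hinner]
      rw [integral_complex_ofReal, ← ofReal_norm, Complex.norm_real, Real.norm_of_nonneg hnn]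
    rw [e2, houter]
    refine (enorm_integral_le_lintegral_enorm _).trans ?_
    have hkm : Measurable (Function.uncurry fun E E' : ℝ =>
        ENNReal.ofReal (Real.exp (-(T * (E - E')) ^ 2 / 4))) := by
      unfold Function.uncurry
      fun_prop
    have hsch := lintegral_lintegral_mul_le μ hf.1.enorm hkm
      (fun E E' => by rw [← neg_sub E' E, mul_neg, neg_sq]) hB
    refine le_trans (le_of_eq ?_) (mul_le_mul_right hsch _)
    rw [← lintegral_const_mul' _ _ ENNReal.ofReal_ne_top]
    refine lintegral_congr fun p => ?_
    rw [enorm_mul, enorm_mul, ← ofReal_norm (((_ : ℝ) : ℂ)), Complex.norm_real,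
      Real.norm_of_nonneg (by positivity), ENNReal.ofReal_mul (by positivity),
      show ‖starRingEnd ℂ (f p.2)‖ₑ = ‖f p.2‖ₑ by simp [enorm_eq_nnnorm]]
    ring
  -- On `(0, T]` the Gaussian weight is at least `e^{-1}`, whence the factor `e`.
  calc ∫⁻ t in Set.Ioc 0 T, ‖F t‖ₑ ^ 2
      ≤ ∫⁻ t in Set.Ioc 0 T, ENNReal.ofReal (Real.exp 1) * (ENNReal.ofReal (G t) * ‖F t‖ₑ ^ 2) := by
        refine setLIntegral_mono' measurableSet_Ioc fun t ht => ?_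
        rw [← mul_assoc, ← ENNReal.ofReal_mul (Real.exp_pos _).le]
        refine le_mul_of_one_le_left' ?_
        rw [ENNReal.one_le_ofReal, hG, ← Real.exp_add]
        refine Real.one_le_exp ?_
        have h1 : t / T ≤ 1 := (div_le_one hT).2 ht.2
        have h0 : 0 ≤ t / T := div_nonneg ht.1.le hT.le
        nlinarith
    _ ≤ ENNReal.ofReal (Real.exp 1) * ∫⁻ t, ENNReal.ofReal (G t) * ‖F t‖ₑ ^ 2 := by
        rw [← lintegral_const_mul' _ _ ENNReal.ofReal_ne_top]
        exact setLIntegral_le_lintegral _ _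
    _ ≤ _ := by
        rw [ENNReal.ofReal_mul (Real.exp_pos _).le, mul_assoc]
        gcongr

end Strichartz

/-! ### Mass inside and outside of balls -/

section Mass

variable {X : Type*} [MeasurableSpace X] {ν : Measure X}

lemma eLpNorm_two_sq {E : Type*} [NormedAddCommGroup E] (f : X → E) (ν : Measure X) :
    eLpNorm f 2 ν ^ 2 = ∫⁻ x, ‖f x‖ₑ ^ 2 ∂ν := by
  have := eLpNorm_nnreal_pow_eq_lintegral (f := f) (μ := ν) (p := 2) two_ne_zero
  norm_num at this
  exact this

lemma ofReal_norm_sq_eq_lintegral (f : Lp ℂ 2 ν) :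
    ENNReal.ofReal (‖f‖ ^ 2) = ∫⁻ x, ‖f x‖ₑ ^ 2 ∂ν := by
  rw [← eLpNorm_two_sq, Lp.norm_def, ENNReal.ofReal_pow ENNReal.toReal_nonneg,
    ENNReal.ofReal_toReal (Lp.eLpNorm_ne_top f)]

/-- If `f = f₁ + f₂` with `f₁`, `f₂` orthogonal, then `f₁` being small on `B` forces `f` to have mass
outside of `B`. -/
lemma half_norm_sq_le_lintegral_compl {f f₁ f₂ : Lp ℂ 2 ν} (hadd : f₁ + f₂ = f)
    (hsq : ‖f₁‖ ^ 2 + ‖f₂‖ ^ 2 = ‖f‖ ^ 2) (h₁ : 0 < ‖f₁‖) {B : Set X} (hB : MeasurableSet B) :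
    ENNReal.ofReal (‖f₁‖ ^ 2 / 2) ≤ ∫⁻ x in Bᶜ, ‖f x‖ₑ ^ 2 ∂ν +
      ENNReal.ofReal (1 + 2 * ‖f‖ ^ 2 / ‖f₁‖ ^ 2) * ∫⁻ x in B, ‖f₁ x‖ₑ ^ 2 ∂ν := by
  have hfin : ∀ (g : Lp ℂ 2 ν) (A : Set X), eLpNorm g 2 (ν.restrict A) ≠ ⊤ := fun g A =>
    ((Lp.memLp g).restrict A).2.ne
  set a := (eLpNorm f₁ 2 (ν.restrict B)).toReal with ha
  set b := (eLpNorm f 2 (ν.restrict B)).toReal with hb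
  set c := (eLpNorm f 2 (ν.restrict Bᶜ)).toReal with hc
  have ea : ∫⁻ x in B, ‖f₁ x‖ₑ ^ 2 ∂ν = ENNReal.ofReal (a ^ 2) := by
    rw [← eLpNorm_two_sq, ENNReal.ofReal_pow ENNReal.toReal_nonneg, ENNReal.ofReal_toReal (hfin _ _)]
  have eb : ∫⁻ x in B, ‖f x‖ₑ ^ 2 ∂ν = ENNReal.ofReal (b ^ 2) := by
    rw [← eLpNorm_two_sq, ENNReal.ofReal_pow ENNReal.toReal_nonneg, ENNReal.ofReal_toReal (hfin _ _)]
  have ec : ∫⁻ x in Bᶜ, ‖f x‖ₑ ^ 2 ∂ν = ENNReal.ofReal (c ^ 2) := by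
    rw [← eLpNorm_two_sq, ENNReal.ofReal_pow ENNReal.toReal_nonneg, ENNReal.ofReal_toReal (hfin _ _)]
  have hbc : b ^ 2 + c ^ 2 = ‖f‖ ^ 2 := by
    have := lintegral_add_compl (μ := ν) (fun x => ‖f x‖ₑ ^ 2) hB
    rw [eb, ec, ← ofReal_norm_sq_eq_lintegral, ← ENNReal.ofReal_add (sq_nonneg _) (sq_nonneg _)] at this
    exact (ENNReal.ofReal_eq_ofReal_iff (by positivity) (by positivity)).1 this
  have hab : b ≤ a + ‖f₂‖ := by
    have h1 : eLpNorm f 2 (ν.restrict B) ≤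
        eLpNorm f₁ 2 (ν.restrict B) + eLpNorm f₂ 2 (ν.restrict B) := by
      have h2 : f =ᵐ[ν.restrict B] ⇑f₁ + ⇑f₂ := by
        rw [← hadd]
        exact ae_restrict_of_ae (Lp.coeFn_add f₁ f₂)
      rw [eLpNorm_congr_ae h2]
      exact eLpNorm_add_le (Lp.aestronglyMeasurable f₁).restrict
        (Lp.aestronglyMeasurable f₂).restrict one_le_two
    have h3 : eLpNorm f₂ 2 (ν.restrict B) ≤ eLpNorm f₂ 2 ν :=
      eLpNorm_mono_measure _ Measure.restrict_le_self
    have h4 := ENNReal.toReal_mono (ENNReal.add_ne_top.2 ⟨hfin f₁ B, Lp.eLpNorm_ne_top f₂⟩)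
      (h1.trans (by gcongr))
    rwa [ENNReal.toReal_add (hfin f₁ B) (Lp.eLpNorm_ne_top f₂)] at h4
  have ha0 : 0 ≤ a := ENNReal.toReal_nonneg
  have hb0 : 0 ≤ b := ENNReal.toReal_nonneg
  rw [ec, ea, ← ENNReal.ofReal_mul (by positivity), ← ENNReal.ofReal_add (by positivity) (by positivity)]
  refine ENNReal.ofReal_le_ofReal ?_
  set s := ‖f₁‖ with hs
  set q := ‖f₂‖ with hq
  have hq0 : 0 ≤ q := norm_nonneg _
  have hbsq : b ^ 2 ≤ (a + q) ^ 2 := by gcongr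
  -- The mass outside satisfies `c² = s² + q² - b² ≥ s² - a² - 2aq`. Young's inequality is weighted
  -- so that the cross term costs only half of `s²`.
  have hyoung : 2 * a * q ≤ 2 * ‖f‖ ^ 2 / s ^ 2 * a ^ 2 + s ^ 2 / 2 := by
    have h5 : 2 * a * q ≤ 2 * (q ^ 2 / s ^ 2) * a ^ 2 + s ^ 2 / 2 := by
      have : 2 * (q ^ 2 / s ^ 2) * a ^ 2 + s ^ 2 / 2 - 2 * a * q = 2 * (q * a / s - s / 2) ^ 2 := by
        field_simp
        ring
      nlinarith [sq_nonneg (q * a / s - s / 2)]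
    refine h5.trans ?_
    have : q ^ 2 ≤ ‖f‖ ^ 2 := by nlinarith [sq_nonneg s]
    rw [mul_div_assoc]
    gcongr
  nlinarith

/-- Mass outside of the ball of radius `R` bounds moments from below. -/
lemma ofReal_rpow_mul_lintegral_le {ρ : X → ℝ} (hρ : Measurable ρ) {m R : ℝ} (hm : 0 < m)
    (hR : 0 ≤ R) (f : X → ℂ) :
    ENNReal.ofReal (R ^ m) * ∫⁻ x in {x | R ≤ ρ x}, ‖f x‖ₑ ^ 2 ∂ν ≤
      ∫⁻ x, ENNReal.ofReal (ρ x ^ m) * ‖f x‖ₑ ^ 2 ∂ν := by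
  rw [← lintegral_const_mul' _ _ ENNReal.ofReal_ne_top]
  refine le_trans ?_ (setLIntegral_le_lintegral {x | R ≤ ρ x} _)
  refine setLIntegral_mono' (measurableSet_le measurable_const hρ) fun x hx => ?_
  have : R ^ m ≤ ρ x ^ m := Real.rpow_le_rpow hR hx hm.le
  gcongr

end Mass

/-! ### The spectral part of the evolution as an integral operator -/

section Kernel

variable {X : Type*} [MeasurableSpace X] {ν : Measure X} [SFinite ν] {ρ : X → ℝ}

/-- The mass distribution `A ↦ ∫_A ∫_S |w(x, E)|² dμ(E) dν(x)`. -/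
def kernelMeasure (ν : Measure X) (μ : Measure ℝ) (S : Set ℝ) (w : X × ℝ → ℂ) : Measure X :=
  ν.withDensity fun x => ∫⁻ E in S, ‖w (x, E)‖ₑ ^ 2 ∂μ

lemma kernelMeasure_apply (μ : Measure ℝ) (S : Set ℝ) (w : X × ℝ → ℂ) (A : Set X) :
    kernelMeasure ν μ S w A = ∫⁻ x in A, ∫⁻ E in S, ‖w (x, E)‖ₑ ^ 2 ∂μ ∂ν :=
  withDensity_apply' _ A

variable {H : Lp ℂ 2 ν →ₗ.[ℂ] Lp ℂ 2 ν} {ψ : Lp ℂ 2 ν} {u : X → ℝ → ℂ}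

/-- The kernel formula is known for `U`, so its adjoint is reached by duality. Test the difference
`g` of the two sides, cut off to the ball, against both: finiteness of the kernel mass makes the
kernel square integrable on the product, Fubini applies, and the two inner products agree, so `∫_B
|g|² = 0`. The conjugate on the kernel comes from taking the adjoint. -/
lemma spectral_part_eq_integral (hρ : Measurable ρ)
    {U : cyclicSubspace H ψ ≃ₗᵢ[ℂ] Lp ℂ 2 (spectralMeasure H ψ)}
    (hu : ∀ (φ : Lp ℂ 2 ν) (R : ℝ), (∀ᵐ x ∂ν, R ≤ ρ x → φ x = 0) →
      ∀ᵐ E ∂(spectralMeasure H ψ), Integrable (fun x => u x E * φ x) ν ∧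
        U ((cyclicSubspace H ψ).orthogonalProjectionOnto φ) E = ∫ x, u x E * φ x ∂ν)
    {w : X × ℝ → ℂ} (hw : StronglyMeasurable w)
    (huw : ∀ᵐ E ∂(spectralMeasure H ψ), ∀ᵐ x ∂ν, u x E = w (x, E))
    {S : Set ℝ} (hS : MeasurableSet S) {R : ℝ}
    (hfin : kernelMeasure ν (spectralMeasure H ψ) S w {x | ρ x < R} ≠ ⊤) (t : ℝ) :
    ∀ᵐ x ∂(ν.restrict {x | ρ x < R}),
      ((U.symm (phaseLp (spectralMeasure H ψ) S hS t) : cyclicSubspace H ψ) : Lp ℂ 2 ν) x =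
        ∫ E in S, phase t E * starRingEnd ℂ (w (x, E)) ∂(spectralMeasure H ψ) := by
  set B : Set X := {x | ρ x < R} with hBdef
  have hB : MeasurableSet B := measurableSet_lt hρ measurable_const
  set ξ : Lp ℂ 2 ν := ((U.symm (phaseLp (spectralMeasure H ψ) S hS t) : cyclicSubspace H ψ) :
    Lp ℂ 2 ν) with hξ
  set k : X → ℂ := fun x => ∫ E in S, phase t E * starRingEnd ℂ (w (x, E)) ∂(spectralMeasure H ψ) with hk
  have hww : MemLp w 2 ((ν.restrict B).prod ((spectralMeasure H ψ).restrict S)) := by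
    refine ⟨hw.aestronglyMeasurable, ?_⟩
    have h2 : eLpNorm w 2 ((ν.restrict B).prod ((spectralMeasure H ψ).restrict S)) ^ 2 ≠ ⊤ := by
      rw [eLpNorm_two_sq, lintegral_prod _ (hw.enorm.pow_const 2).aemeasurable,
        ← kernelMeasure_apply]
      exact hfin
    exact lt_top_iff_ne_top.2 fun h => h2 (by rw [h]; simp)
  have hph : StronglyMeasurable fun p : X × ℝ => phase t p.2 :=
    (continuous_phase t).stronglyMeasurable.comp_measurable measurable_snd
  have hkm : StronglyMeasurable k := by
    have : StronglyMeasurable fun p : X × ℝ => phase t p.2 * starRingEnd ℂ (w p) :=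
      hph.mul (Complex.continuous_conj.comp_stronglyMeasurable hw)
    exact this.integral_prod_right
  have hkL : MemLp k 2 (ν.restrict B) := by
    refine ⟨hkm.aestronglyMeasurable, ?_⟩
    -- Cauchy-Schwarz in `E` against the constant `1` on `S`.
    have hbound : ∀ x, ‖k x‖ₑ ^ 2 ≤ (spectralMeasure H ψ) S * ∫⁻ E in S, ‖w (x, E)‖ₑ ^ 2 ∂(spectralMeasure H ψ) := by
      intro x
      have h1 : ‖k x‖ₑ ≤ ∫⁻ E in S, 1 * ‖w (x, E)‖ₑ ∂(spectralMeasure H ψ) := by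
        refine (enorm_integral_le_lintegral_enorm _).trans (lintegral_mono fun E => ?_)
        rw [enorm_mul, ← ofReal_norm (phase t E), norm_phase]
        simp [enorm_eq_nnnorm]
      have h2 := ENNReal.lintegral_mul_le_Lp_mul_Lq ((spectralMeasure H ψ).restrict S) Real.HolderConjugate.two_two
        (f := fun _ => 1) (g := fun E => ‖w (x, E)‖ₑ) aemeasurable_const
        (hw.comp_measurable measurable_prodMk_left).enorm.aemeasurable
      have h3 := pow_le_pow_left₀ zero_le (h1.trans h2) 2
      refine h3.trans (le_of_eq ?_)
      rw [mul_pow, ← ENNReal.rpow_natCast, ← ENNReal.rpow_natCast, ← ENNReal.rpow_mul,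
        ← ENNReal.rpow_mul]
      simp
    have h2 : eLpNorm k 2 (ν.restrict B) ^ 2 ≠ ⊤ := by
      rw [eLpNorm_two_sq]
      refine ne_top_of_le_ne_top ?_ (lintegral_mono hbound)
      rw [lintegral_const_mul' _ _ (measure_ne_top _ _), ← kernelMeasure_apply]
      exact ENNReal.mul_ne_top (measure_ne_top _ _) hfin
    exact lt_top_iff_ne_top.2 fun h => h2 (by rw [h]; simp)
  set g : X → ℂ := fun x => ξ x - k x with hg
  have hgL : MemLp g 2 (ν.restrict B) := ((Lp.memLp ξ).restrict B).sub hkL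
  have hgi : MemLp (B.indicator g) 2 ν := (memLp_indicator_iff_restrict hB).2 hgL
  set φ : Lp ℂ 2 ν := hgi.toLp _ with hφ
  have hφg : φ =ᵐ[ν] B.indicator g := hgi.coeFn_toLp
  have hUφ := hu φ R (by
    filter_upwards [hφg] with x hx hxR
    rw [hx, Set.indicator_of_notMem]
    simpa [hBdef] using hxR)
  have hUφ' : ∀ᵐ E ∂(spectralMeasure H ψ), U ((cyclicSubspace H ψ).orthogonalProjectionOnto φ) E =
      ∫ x in B, w (x, E) * g x ∂ν := by
    filter_upwards [hUφ, huw] with E hE hEw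
    rw [hE.2, ← integral_indicator hB]
    refine integral_congr_ae ?_
    filter_upwards [hEw, hφg] with x h1 h2
    rw [h1, h2]
    by_cases hx : x ∈ B <;> simp [hx]
  have hFi : Integrable (fun p : X × ℝ => phase t p.2 * starRingEnd ℂ (w p * g p.1))
      ((ν.restrict B).prod ((spectralMeasure H ψ).restrict S)) := by
    have h1 : MemLp (fun p : X × ℝ => g p.1) 2 ((ν.restrict B).prod ((spectralMeasure H ψ).restrict S)) :=
      hgL.comp_fst _
    have h2 : Integrable (fun p : X × ℝ => w p * g p.1) ((ν.restrict B).prod ((spectralMeasure H ψ).restrict S)) :=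
      hww.integrable_mul h1
    have h3 : Integrable (fun p : X × ℝ => starRingEnd ℂ (w p * g p.1))
        ((ν.restrict B).prod ((spectralMeasure H ψ).restrict S)) := by
      rw [← memLp_one_iff_integrable] at h2 ⊢
      exact h2.star
    exact h3.bdd_mul (c := 1) hph.aestronglyMeasurable
      (Eventually.of_forall fun p => (norm_phase _ _).le)
  have hL1 : ⟪φ, ξ⟫_ℂ = ∫ x in B, k x * starRingEnd ℂ (g x) ∂ν := by
    rw [hξ, inner_spectralRepresentation_symm]
    calc _ = ∫ E in S, phase t E * starRingEnd ℂ (∫ x in B, w (x, E) * g x ∂ν) ∂(spectralMeasure H ψ) := by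
          rw [← integral_indicator hS]
          refine integral_congr_ae ?_
          filter_upwards [coeFn_phaseLp (spectralMeasure H ψ) S hS t, hUφ'] with E h1 h2
          rw [h1, h2]
          by_cases hE : E ∈ S <;> simp [hE]
      _ = ∫ E in S, ∫ x in B, phase t E * starRingEnd ℂ (w (x, E) * g x) ∂ν ∂(spectralMeasure H ψ) := by
          refine integral_congr_ae (Eventually.of_forall fun E => ?_)
          simp only
          rw [integral_const_mul, integral_conj]
      _ = ∫ x in B, ∫ E in S, phase t E * starRingEnd ℂ (w (x, E) * g x) ∂(spectralMeasure H ψ) ∂ν := by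
          rw [← integral_prod_symm _ hFi, integral_prod _ hFi]
      _ = _ := by
          refine integral_congr_ae (Eventually.of_forall fun x => ?_)
          simp only [hk, map_mul]
          rw [← integral_mul_const]
          simp only [mul_assoc]
  have hL2 : ⟪φ, ξ⟫_ℂ = ∫ x in B, ξ x * starRingEnd ℂ (g x) ∂ν := by
    rw [L2.inner_def, ← integral_indicator hB]
    refine integral_congr_ae ?_
    filter_upwards [hφg] with x hx
    rw [hx, RCLike.inner_apply]
    by_cases hxB : x ∈ B <;> simp [hxB]
  have hzero : ∫ x in B, ‖g x‖ ^ 2 ∂ν = 0 := by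
    have hi1 : Integrable (fun x => ξ x * starRingEnd ℂ (g x)) (ν.restrict B) :=
      ((Lp.memLp ξ).restrict B).integrable_mul hgL.star
    have hi2 : Integrable (fun x => k x * starRingEnd ℂ (g x)) (ν.restrict B) :=
      hkL.integrable_mul hgL.star
    have h3 : ∫ x in B, ((‖g x‖ ^ 2 : ℝ) : ℂ) ∂ν = 0 := by
      have h4 := sub_eq_zero.2 (hL2.symm.trans hL1)
      rw [← integral_sub hi1 hi2] at h4
      rw [← h4]
      refine integral_congr_ae (Eventually.of_forall fun x => ?_)
      simp only
      rw [← sub_mul, Complex.ofReal_pow, ← Complex.mul_conj']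
    rw [integral_complex_ofReal] at h3
    exact_mod_cast h3
  rw [integral_eq_zero_iff_of_nonneg (fun x => by positivity)
    (hgL.integrable_norm_pow two_ne_zero)] at hzero
  filter_upwards [hzero] with x hx
  simp only [Pi.zero_apply, ne_eq, OfNat.ofNat_ne_zero, not_false_eq_true, pow_eq_zero_iff,
    norm_eq_zero] at hx
  exact sub_eq_zero.1 hx

lemma measurable_kernel_integral (μ : Measure ℝ) [SFinite μ] {w : X × ℝ → ℂ}
    (hw : StronglyMeasurable w) (S : Set ℝ) :
    StronglyMeasurable fun p : ℝ × X => ∫ E in S, phase p.1 E * starRingEnd ℂ (w (p.2, E)) ∂μ := by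
  have h1 : StronglyMeasurable fun q : (ℝ × X) × ℝ => phase q.1.1 q.2 :=
    continuous_uncurry_phase.stronglyMeasurable.comp_measurable
      (measurable_fst.fst.prodMk measurable_snd)
  have h2 : StronglyMeasurable fun q : (ℝ × X) × ℝ => starRingEnd ℂ (w (q.1.2, q.2)) :=
    Complex.continuous_conj.comp_stronglyMeasurable
      (hw.comp_measurable (measurable_fst.snd.prodMk measurable_snd))
  exact (h1.mul h2).integral_prod_right

/-- After Tonelli, Strichartz' bound is applied at each `x` to the density `conj w(x, ·)`, and
integration in `x` assembles the right-hand sides into the kernel mass of `A`. -/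
lemma lintegral_kernel_integral_le (μ : Measure ℝ) [IsFiniteMeasure μ] {w : X × ℝ → ℂ}
    (hw : StronglyMeasurable w) {S : Set ℝ} {A : Set X}
    (hfin : kernelMeasure ν μ S w A ≠ ⊤) {T : ℝ} (hT : 0 < T) {B : ℝ≥0∞}
    (hB : ∀ᵐ E ∂(μ.restrict S),
      ∫⁻ E' in S, ENNReal.ofReal (Real.exp (-(T * (E - E')) ^ 2 / 4)) ∂μ ≤ B) :
    ∫⁻ t in Set.Ioc 0 T, ∫⁻ x in A, ‖∫ E in S, phase t E * starRingEnd ℂ (w (x, E)) ∂μ‖ₑ ^ 2 ∂ν ≤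
      ENNReal.ofReal (Real.exp 1 * (√Real.pi * T)) * (B * kernelMeasure ν μ S w A) := by
  have hm := (measurable_kernel_integral μ hw S).enorm.pow_const 2
  rw [lintegral_lintegral_swap (f := fun t x =>
    ‖∫ E in S, phase t E * starRingEnd ℂ (w (x, E)) ∂μ‖ₑ ^ 2) hm.aemeasurable]
  have hwm : Measurable fun x => ∫⁻ E in S, ‖w (x, E)‖ₑ ^ 2 ∂μ :=
    (hw.enorm.pow_const 2).lintegral_prod_right'
  rw [kernelMeasure_apply] at hfin ⊢
  rw [← mul_assoc, ← lintegral_const_mul _ hwm]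
  refine lintegral_mono_ae ?_
  filter_upwards [ae_lt_top hwm hfin] with x hx
  have hfx : MemLp (fun E => starRingEnd ℂ (w (x, E))) 2 (μ.restrict S) := by
    refine MemLp.star (f := fun E => w (x, E))
      ⟨(hw.comp_measurable measurable_prodMk_left).aestronglyMeasurable, ?_⟩
    rw [← eLpNorm_two_sq] at hx
    exact lt_top_iff_ne_top.2 fun h => hx.ne (by rw [h]; simp)
  refine (lintegral_sq_integral_phase_le (μ.restrict S) hfx hT hB).trans (le_of_eq ?_)
  rw [mul_assoc]
  simp [enorm_eq_nnnorm]

end Kernel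

/-! ### Mass escapes from balls -/

section Escape

variable {X : Type*} [MeasurableSpace X] {ν : Measure X} {ρ : X → ℝ}

/-- A single `N` serves as threshold and as constant, so that the admissible energies form a
sequence of sets increasing in `N`. -/
lemma exists_bound_of_hasGrowth {γ : ℝ} {f : X → ℂ} (hf : HasGrowth ν ρ γ f) :
    ∃ N : ℕ, ∀ n : ℕ, N ≤ n → sqNormBall ν ρ f n ≤ ENNReal.ofReal (N * (n : ℝ) ^ γ) := by
  obtain ⟨c, hc1, hc2⟩ := ENNReal.lt_iff_exists_nnreal_btwn.1 hf
  obtain ⟨R₀, hR₀⟩ := eventually_atTop.1 (eventually_lt_of_limsup_lt hc1)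
  obtain ⟨N₁, hN₁⟩ := exists_nat_ge R₀
  obtain ⟨N₂, hN₂⟩ := exists_nat_ge (c : ℝ)
  refine ⟨max (max N₁ N₂) 1, fun n hn => ?_⟩
  simp only [max_le_iff] at hn
  have hn0 : (0 : ℝ) < n := by exact_mod_cast hn.2
  have h1 := hR₀ n (hN₁.trans (by exact_mod_cast hn.1.1))
  have h2 : (c : ℝ) ≤ ((max (max N₁ N₂) 1 : ℕ) : ℝ) :=
    hN₂.trans (by exact_mod_cast (le_max_right N₁ N₂).trans (le_max_left _ _))
  calc sqNormBall ν ρ f n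
      = ENNReal.ofReal ((n : ℝ) ^ γ) * (ENNReal.ofReal ((n : ℝ) ^ (-γ)) * sqNormBall ν ρ f n) := by
        rw [← mul_assoc, ← ENNReal.ofReal_mul (by positivity), ← Real.rpow_add hn0]
        simp
    _ ≤ ENNReal.ofReal ((n : ℝ) ^ γ) * c := by gcongr
    _ = ENNReal.ofReal (c * (n : ℝ) ^ γ) := by
        rw [mul_comm (c : ℝ), ENNReal.ofReal_mul (by positivity), ENNReal.ofReal_coe_nnreal]
    _ ≤ _ := ENNReal.ofReal_le_ofReal (by gcongr)

variable [SFinite ν]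

/-- Some part of `S` of positive measure has uniform Hölder and growth bounds. -/
lemma exists_uniform_subset (μ : Measure ℝ) [IsFiniteMeasure μ] {u : X → ℝ → ℂ} {w : X × ℝ → ℂ}
    (hw : StronglyMeasurable w) (huw : ∀ᵐ E ∂μ, ∀ᵐ x ∂ν, u x E = w (x, E)) {α γ : ℝ} (hα : 0 ≤ α)
    {S : Set ℝ} (hS : MeasurableSet S) (hpos : 0 < μ S)
    (hcont : IsAlphaContinuous α (μ.restrict S))
    (hgrowth : ∀ E ∈ S, HasGrowth ν ρ γ (fun x => u x E)) :
    ∃ (S' : Set ℝ) (N : ℕ), MeasurableSet S' ∧ 0 < μ S' ∧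
      (∀ E ∈ S', ∀ n : ℕ, N ≤ n →
        ∫⁻ x in {x | ρ x < n}, ‖w (x, E)‖ₑ ^ 2 ∂ν ≤ ENNReal.ofReal (N * (n : ℝ) ^ γ)) ∧
      ∀ E ∈ S', ∀ r : ℝ, 0 < r → μ.restrict S' (Metric.ball E r) ≤ ENNReal.ofReal (N * r ^ α) := by
  set K : ℕ → Set ℝ := holderSet α (μ.restrict S) with hK
  -- Only integer radii are imposed, so that `G N` is a countable intersection, and the strongly
  -- measurable `w` replaces `u`; both serve the measurability of `G N`.
  set G : ℕ → Set ℝ := fun N => {E | ∀ n : ℕ, N ≤ n →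
        ∫⁻ x in {x | ρ x < n}, ‖w (x, E)‖ₑ ^ 2 ∂ν ≤ ENNReal.ofReal (N * (n : ℝ) ^ γ)} with hG
  have hGm : ∀ N, MeasurableSet (G N) := by
    intro N
    simp only [hG, Set.ofPred_forall]
    refine MeasurableSet.iInter fun n => MeasurableSet.iInter fun _ =>
      measurableSet_le ?_ measurable_const
    exact (hw.enorm.pow_const 2).lintegral_prod_left'
  have hGmono : Monotone G := by
    intro N M hNM E hE n hn
    refine (hE n (hNM.trans hn)).trans (ENNReal.ofReal_le_ofReal ?_)
    have : (N : ℝ) ≤ M := by exact_mod_cast hNM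
    gcongr
  have hae : ∀ᵐ E ∂(μ.restrict S), E ∈ ⋃ N, G N ∩ K N := by
    -- `α`-continuity enters here: the energies with no Hölder constant are Hausdorff null, hence
    -- null for the restricted measure.
    have h1 : ∀ᵐ E ∂(μ.restrict S), E ∉ ⋂ N, (K N)ᶜ :=
      measure_eq_zero_iff_ae_notMem.1 (hcont _ (hausdorffMeasure_compl_holderSet hα _))
    filter_upwards [h1, ae_restrict_mem hS, ae_restrict_of_ae huw] with E hE hES hEw
    simp only [Set.mem_iInter, Set.mem_compl_iff, not_forall, not_not] at hE
    obtain ⟨N₁, hN₁⟩ := hE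
    obtain ⟨N₂, hN₂⟩ := exists_bound_of_hasGrowth (hgrowth E hES)
    refine Set.mem_iUnion.2 ⟨max N₁ N₂, hGmono (le_max_right _ _) fun n hn => ?_,
      holderSet_mono α _ (le_max_left _ _) hN₁⟩
    refine le_trans (le_of_eq ?_) (hN₂ n hn)
    refine lintegral_congr_ae (ae_restrict_of_ae ?_)
    filter_upwards [hEw] with x hx
    rw [hx]
  have hex : ∃ N, μ.restrict S (G N ∩ K N) ≠ 0 := by
    by_contra! hne
    have h1 : μ.restrict S (⋃ N, G N ∩ K N) = 0 := measure_iUnion_null hne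
    have h2 : ∀ᵐ _ ∂(μ.restrict S), False := by
      filter_upwards [hae, measure_eq_zero_iff_ae_notMem.1 h1] with E hE1 hE2
      exact hE2 hE1
    rw [eventually_false_iff_eq_bot, ae_eq_bot, Measure.restrict_eq_zero] at h2
    exact hpos.ne' h2
  obtain ⟨N, hN⟩ := hex
  have hKm : MeasurableSet (K N) := (isClosed_holderSet _ _ _).measurableSet
  have hm := (hGm N).inter hKm
  refine ⟨G N ∩ K N ∩ S, N, hm.inter hS, ?_, fun E hE => hE.1.1, fun E hE r hr => ?_⟩
  · rw [Measure.restrict_apply hm] at hN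
    exact pos_iff_ne_zero.2 hN
  · exact (Measure.restrict_mono_set μ Set.inter_subset_right _).trans (hE.1.2 r hr)

variable {H : Lp ℂ 2 ν →ₗ.[ℂ] Lp ℂ 2 ν} {ψ : Lp ℂ 2 ν} {u : X → ℝ → ℂ}

/-- The time averaged mass outside of balls is bounded below, up to an error that is controlled by the
mass `M` of the generalized eigenfunctions inside. -/
theorem exists_escape_bound (hρ : Measurable ρ) (hH : IsSymmetricMaximal H)
    (hu : AreGeneralizedEigenfunctions ν ρ H ψ u) {α γ : ℝ} (hα0 : 0 ≤ α) (hα1 : α ≤ 1)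
    {S : Set ℝ} (hS : MeasurableSet S) (hpos : 0 < spectralMeasure H ψ S)
    (hcont : IsAlphaContinuous α ((spectralMeasure H ψ).restrict S))
    (hgrowth : ∀ E ∈ S, HasGrowth ν ρ γ (fun x => u x E)) :
    ∃ (s κ D : ℝ) (N : ℕ) (M : Measure X), 0 < s ∧ 0 ≤ κ ∧ 0 ≤ D ∧ M ≪ ν ∧
      (∀ n : ℕ, N ≤ n → M {x | ρ x < n} ≤ ENNReal.ofReal (D * (n : ℝ) ^ γ)) ∧
      ∀ T R : ℝ, 0 < T → ENNReal.ofReal s ≤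
        ENNReal.ofReal (1 / T) *
          (∫⁻ t in Set.Ioc 0 T, ∫⁻ x in {x | R ≤ ρ x}, ‖evolution H ψ t x‖ₑ ^ 2 ∂ν) +
        ENNReal.ofReal (κ * T ^ (-α)) * M {x | ρ x < R} := by
  obtain ⟨hum, U, hU, hker⟩ := hu
  set w : X × ℝ → ℂ := hum.mk _ with hwdef
  have hw : StronglyMeasurable w := hum.stronglyMeasurable_mk
  have huw : ∀ᵐ E ∂(spectralMeasure H ψ), ∀ᵐ x ∂ν, u x E = w (x, E) := by
    have h1 := Measure.ae_ae_of_ae_prod (Measure.measurePreserving_swap.quasiMeasurePreserving.ae hum.ae_eq_mk)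
    exact h1
  obtain ⟨S', N, hS', hpos', hgr, hhol⟩ :=
    exists_uniform_subset (spectralMeasure H ψ) hw huw hα0 hS hpos hcont hgrowth
  set M := kernelMeasure ν (spectralMeasure H ψ) S' w with hM
  set D : ℝ := N * (spectralMeasure H ψ).real S' with hD
  have hMn : ∀ n : ℕ, N ≤ n → M {x | ρ x < n} ≤ ENNReal.ofReal (D * (n : ℝ) ^ γ) := by
    intro n hn
    rw [hM, kernelMeasure_apply, lintegral_lintegral_swap (hw.enorm.pow_const 2).aemeasurable]
    calc _ ≤ ∫⁻ _ in S', ENNReal.ofReal (N * (n : ℝ) ^ γ) ∂(spectralMeasure H ψ) :=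
          setLIntegral_mono' hS' fun E hE => hgr E hE n hn
      _ = _ := by
          rw [setLIntegral_const, ← ofReal_measureReal, ← ENNReal.ofReal_mul (by positivity), hD]
          congr 1
          ring
  have hMfin : ∀ R : ℝ, M {x | ρ x < R} ≠ ⊤ := by
    intro R
    obtain ⟨n, hn⟩ := exists_nat_ge R
    refine ne_top_of_le_ne_top ENNReal.ofReal_ne_top
      ((measure_mono fun x hx => ?_).trans (hMn (max n N) (le_max_right _ _)))
    have : (n : ℝ) ≤ (max n N : ℕ) := by exact_mod_cast le_max_left _ _
    simp only [Set.mem_ofPred_eq] at hx ⊢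
    linarith
  set f₁ : ℝ → Lp ℂ 2 ν := fun t =>
    ((U.symm (phaseLp (spectralMeasure H ψ) S' hS' t) : cyclicSubspace H ψ) : Lp ℂ 2 ν) with hf₁
  set f₂ : ℝ → Lp ℂ 2 ν := fun t =>
    ((U.symm (phaseLp (spectralMeasure H ψ) S'ᶜ hS'.compl t) : cyclicSubspace H ψ) : Lp ℂ 2 ν)
    with hf₂
  have hn₁ : ∀ t, ‖f₁ t‖ ^ 2 = (spectralMeasure H ψ).real S' := fun t => by
    simp only [hf₁]
    rw [Submodule.norm_coe, U.symm.norm_map, norm_phaseLp_sq]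
  have hn₂ : ∀ t, ‖f₂ t‖ ^ 2 = (spectralMeasure H ψ).real S'ᶜ := fun t => by
    simp only [hf₂]
    rw [Submodule.norm_coe, U.symm.norm_map, norm_phaseLp_sq]
  set σ := (spectralMeasure H ψ).real S' with hσ
  set τ := (spectralMeasure H ψ).real Set.univ with hτ
  have hσ0 : 0 < σ := ENNReal.toReal_pos hpos'.ne' (measure_ne_top _ _)
  set κ₀ : ℝ := 1 + 2 * τ / σ with hκ₀
  have hκ₀0 : 0 ≤ κ₀ := by
    have : 0 ≤ τ := measureReal_nonneg
    positivity
  -- A pointwise-in-time inequality whose constants are independent of `t`, because both norms are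
  -- conserved; it can therefore be averaged over `(0, T]`.
  have hsplit : ∀ (t R : ℝ), ENNReal.ofReal (σ / 2) ≤
      ∫⁻ x in {x | R ≤ ρ x}, ‖evolution H ψ t x‖ₑ ^ 2 ∂ν +
        ENNReal.ofReal κ₀ * ∫⁻ x in {x | ρ x < R},
          ‖∫ E in S', phase t E * starRingEnd ℂ (w (x, E)) ∂(spectralMeasure H ψ)‖ₑ ^ 2 ∂ν := by
    intro t R
    have hadd : f₁ t + f₂ t = evolution H ψ t := by
      simp only [hU.evolution_eq hH, hf₁, hf₂]
      rw [← phaseLp_add_compl _ S' hS', map_add, Submodule.coe_add]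
    have hsq : ‖f₁ t‖ ^ 2 + ‖f₂ t‖ ^ 2 = ‖evolution H ψ t‖ ^ 2 := by
      rw [hn₁, hn₂, hU.norm_evolution_sq hH, measureReal_add_measureReal_compl hS']
    have h₁ : 0 < ‖f₁ t‖ := by
      have := hn₁ t
      by_contra h
      have h0 : ‖f₁ t‖ = 0 := le_antisymm (not_lt.1 h) (norm_nonneg _)
      rw [h0] at this
      norm_num at this
      linarith
    have h := half_norm_sq_le_lintegral_compl hadd hsq h₁ (B := {x | ρ x < R})
      (measurableSet_lt hρ measurable_const)
    rw [hn₁, hU.norm_evolution_sq hH] at h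
    have hcompl : {x | ρ x < R}ᶜ = {x | R ≤ ρ x} := by
      ext x
      simp
    rw [hcompl] at h
    refine h.trans (le_of_eq ?_)
    congr 2
    refine lintegral_congr_ae ?_
    filter_upwards [spectral_part_eq_integral hρ hker hw huw hS' (hMfin R) t] with x hx
    rw [hx]
  -- `κ₀` comes from the splitting, `e √π` from the Gaussian time cutoff, and `N gaussConst` from
  -- the Hölder bound. The factor `T` in Strichartz' bound cancels against `1 / T`.
  set κ : ℝ := κ₀ * (Real.exp 1 * √Real.pi * N * gaussConst.toReal) with hκ
  refine ⟨σ / 2, κ, D, N, M, by positivity, by positivity, by positivity,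
    withDensity_absolutelyContinuous _ _, hMn, fun T R hT => ?_⟩
  set k : ℝ → ℝ≥0∞ := fun t => ∫⁻ x in {x | ρ x < R},
    ‖∫ E in S', phase t E * starRingEnd ℂ (w (x, E)) ∂(spectralMeasure H ψ)‖ₑ ^ 2 ∂ν with hk
  have hkm : Measurable k :=
    ((measurable_kernel_integral (spectralMeasure H ψ) hw S').enorm.pow_const 2).lintegral_prod_right'
  have hkint : ∫⁻ t in Set.Ioc 0 T, k t ≤ ENNReal.ofReal (Real.exp 1 * (√Real.pi * T)) *
      ((ENNReal.ofReal (N * T ^ (-α)) * gaussConst) * M {x | ρ x < R}) := by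
    refine lintegral_kernel_integral_le _ hw (hMfin R) hT ?_
    filter_upwards [ae_restrict_mem hS'] with E hE
    exact lintegral_gaussian_le hα1 _ N.cast_nonneg hT (hhol E hE)
  have hconst : ENNReal.ofReal (1 / T) * (ENNReal.ofReal κ₀ *
      (ENNReal.ofReal (Real.exp 1 * (√Real.pi * T)) *
      ((ENNReal.ofReal (N * T ^ (-α)) * gaussConst) * M {x | ρ x < R}))) =
      ENNReal.ofReal (κ * T ^ (-α)) * M {x | ρ x < R} := by
    rw [← ENNReal.ofReal_toReal gaussConst_ne_top]
    simp only [← mul_assoc]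
    rw [← ENNReal.ofReal_mul (by positivity), ← ENNReal.ofReal_mul (by positivity),
      ← ENNReal.ofReal_mul (by positivity), ← ENNReal.ofReal_mul (by positivity)]
    congr 2
    rw [hκ]
    field_simp
  calc ENNReal.ofReal (σ / 2)
      = ENNReal.ofReal (1 / T) * ∫⁻ _ in Set.Ioc 0 T, ENNReal.ofReal (σ / 2) := by
        rw [setLIntegral_const, Real.volume_Ioc, sub_zero, mul_left_comm,
          ← ENNReal.ofReal_mul (by positivity), one_div_mul_cancel hT.ne', ENNReal.ofReal_one, mul_one]
    _ ≤ ENNReal.ofReal (1 / T) * ∫⁻ t in Set.Ioc 0 T,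
          (∫⁻ x in {x | R ≤ ρ x}, ‖evolution H ψ t x‖ₑ ^ 2 ∂ν + ENNReal.ofReal κ₀ * k t) := by
        gcongr with t
        exact hsplit t R
    _ = ENNReal.ofReal (1 / T) *
          (∫⁻ t in Set.Ioc 0 T, ∫⁻ x in {x | R ≤ ρ x}, ‖evolution H ψ t x‖ₑ ^ 2 ∂ν) +
        ENNReal.ofReal (1 / T) * (ENNReal.ofReal κ₀ * ∫⁻ t in Set.Ioc 0 T, k t) := by
        rw [lintegral_add_right _ (hkm.const_mul _), mul_add,
          lintegral_const_mul _ hkm]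
    _ ≤ _ := by
        rw [← hconst]
        gcongr

end Escape

/-! ### Lower bounds on averaged moments -/

section Moments

variable {X : Type*} [MeasurableSpace X] {ν : Measure X} {ρ : X → ℝ}
  {H : Lp ℂ 2 ν →ₗ.[ℂ] Lp ℂ 2 ν} {ψ : Lp ℂ 2 ν} {u : X → ℝ → ℂ}

lemma ofReal_rpow_mul_average_le (hρ : Measurable ρ) {m R : ℝ} (hm : 0 < m) (hR : 0 ≤ R) (T : ℝ) :
    ENNReal.ofReal (R ^ m) * (ENNReal.ofReal (1 / T) *
      ∫⁻ t in Set.Ioc 0 T, ∫⁻ x in {x | R ≤ ρ x}, ‖evolution H ψ t x‖ₑ ^ 2 ∂ν) ≤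
      averagedMoment ν ρ H ψ m T := by
  rw [averagedMoment, mul_left_comm, ← lintegral_const_mul' _ _ ENNReal.ofReal_ne_top]
  gcongr with t
  exact ofReal_rpow_mul_lintegral_le hρ hm hR _

lemma half_le_of_le_add_half {s : ℝ} (hs : 0 ≤ s) {A : ℝ≥0∞}
    (h : ENNReal.ofReal s ≤ A + ENNReal.ofReal (s / 2)) : ENNReal.ofReal (s / 2) ≤ A := by
  have h1 : ENNReal.ofReal s = ENNReal.ofReal (s / 2) + ENNReal.ofReal (s / 2) := by
    rw [← ENNReal.ofReal_add (by positivity) (by positivity), add_halves]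
  rw [h1] at h
  exact (ENNReal.add_le_add_iff_right ENNReal.ofReal_ne_top).1 h

/-- Combine a bound for large times with a bound on bounded time intervals. -/
lemma exists_bound_of_large_of_bounded {A : ℝ → ℝ≥0∞} {I : Set ℝ} {p : ℝ} (hp : 0 ≤ p)
    (hI : ∀ T ∈ I, 0 < T)
    (hlarge : ∃ C T₁ : ℝ, 0 < C ∧ 0 < T₁ ∧ ∀ T, T₁ ≤ T → ENNReal.ofReal (C * T ^ p) ≤ A T)
    (hbdd : ∀ T₁ : ℝ, 0 < T₁ → ∃ c : ℝ, 0 < c ∧ ∀ T ∈ I, T ≤ T₁ → ENNReal.ofReal c ≤ A T) :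
    ∃ C : ℝ, 0 < C ∧ ∀ T ∈ I, ENNReal.ofReal (C * T ^ p) ≤ A T := by
  obtain ⟨C, T₁, hC, hT₁, h1⟩ := hlarge
  obtain ⟨c, hc, h2⟩ := hbdd T₁ hT₁
  -- Since `p ≥ 0`, `T^p ≤ T₁^p` for `T ≤ T₁`, so a constant bound `c` there dominates `(c / T₁^p)
  -- T^p`.
  refine ⟨min C (c / T₁ ^ p), by positivity, fun T hT => ?_⟩
  have hT0 := hI T hT
  rcases le_total T₁ T with h | h
  · refine le_trans (ENNReal.ofReal_le_ofReal ?_) (h1 T h)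
    have := min_le_left C (c / T₁ ^ p)
    gcongr
  · refine le_trans (ENNReal.ofReal_le_ofReal ?_) (h2 T hT h)
    calc min C (c / T₁ ^ p) * T ^ p ≤ c / T₁ ^ p * T₁ ^ p := by
          gcongr
          exact min_le_right _ _
      _ = c := by
          have : T₁ ^ p ≠ 0 := (Real.rpow_pos_of_pos hT₁ p).ne'
          field_simp

/-- The `L²` norm on `{r ≤ ρ}` varies continuously in time, so at least half of its value at `t₀`
persists for a time `ε`. The portion of `(t₀, t₀ + ε)` inside `(0, T]` has length `min ε (T - t₀)`;
for `T ≤ t₀` the bound degenerates to zero. -/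
lemma exists_moment_bound_near {t₀ r m : ℝ} (ht₀ : 0 ≤ t₀) (hr : 0 < r) (hm : 0 < m)
    (hρ : Measurable ρ) (hcont : Continuous (evolution H ψ))
    (hne : ∫⁻ x in {x | r ≤ ρ x}, ‖evolution H ψ t₀ x‖ₑ ^ 2 ∂ν ≠ 0) :
    ∃ c ε : ℝ, 0 < c ∧ 0 < ε ∧ ∀ T : ℝ, 0 < T →
      ENNReal.ofReal (c * (min ε (T - t₀) / T)) ≤ averagedMoment ν ρ H ψ m T := by
  set A : Set X := {x | r ≤ ρ x} with hA
  set η : ℝ → ℝ≥0∞ := fun t => eLpNorm (⇑(evolution H ψ t)) 2 (ν.restrict A) with hη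
  have hηtop : ∀ t, η t ≠ ⊤ := fun t => ((Lp.memLp _).restrict A).2.ne
  set a : ℝ := (η t₀).toReal with ha
  have ha0 : 0 < a := by
    refine ENNReal.toReal_pos (fun h => hne ?_) (hηtop _)
    rw [← eLpNorm_two_sq, show eLpNorm _ 2 (ν.restrict A) = 0 from h]
    simp
  obtain ⟨ε, hε, hball⟩ := Metric.continuous_iff.1 hcont t₀ (a / 2) (by positivity)
  have hlow : ∀ t, dist t t₀ < ε →
      ENNReal.ofReal ((a / 2) ^ 2) ≤ ∫⁻ x in A, ‖evolution H ψ t x‖ₑ ^ 2 ∂ν := by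
    intro t ht
    have h1 : η t₀ ≤ η t + eLpNorm (⇑(evolution H ψ t₀ - evolution H ψ t)) 2 ν := by
      have h2 : ⇑(evolution H ψ t₀) =ᵐ[ν.restrict A]
          ⇑(evolution H ψ t) + ⇑(evolution H ψ t₀ - evolution H ψ t) := by
        have := Lp.coeFn_add (evolution H ψ t) (evolution H ψ t₀ - evolution H ψ t)
        rw [add_sub_cancel] at this
        exact ae_restrict_of_ae this
      simp only [hη]
      rw [eLpNorm_congr_ae h2]
      refine (eLpNorm_add_le (Lp.aestronglyMeasurable _).restrict
        (Lp.aestronglyMeasurable _).restrict one_le_two).trans ?_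
      exact add_le_add le_rfl (eLpNorm_mono_measure _ Measure.restrict_le_self)
    have h3 := ENNReal.toReal_mono (ENNReal.add_ne_top.2 ⟨hηtop t, Lp.eLpNorm_ne_top _⟩) h1
    rw [ENNReal.toReal_add (hηtop t) (Lp.eLpNorm_ne_top _), ← Lp.norm_def, ← dist_eq_norm,
      dist_comm] at h3
    have h4 := hball t ht
    have h5 : a / 2 ≤ (η t).toReal := by linarith
    rw [← eLpNorm_two_sq, ENNReal.ofReal_pow (by positivity)]
    gcongr
    exact (ENNReal.ofReal_le_iff_le_toReal (hηtop t)).2 h5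
  refine ⟨r ^ m * (a / 2) ^ 2, ε, by positivity, hε, fun T hT => ?_⟩
  refine le_trans ?_ (ofReal_rpow_mul_average_le hρ hm hr.le T)
  rcases le_or_gt T t₀ with hTt | hTt
  · rw [ENNReal.ofReal_of_nonpos]
    · exact zero_le
    · refine mul_nonpos_of_nonneg_of_nonpos (by positivity) (div_nonpos_of_nonpos_of_nonneg ?_ hT.le)
      exact (min_le_right _ _).trans (by linarith)
  set δ := min ε (T - t₀) with hδ
  have hδ0 : 0 < δ := lt_min hε (by linarith)
  have hint : ENNReal.ofReal ((a / 2) ^ 2) * ENNReal.ofReal δ ≤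
      ∫⁻ t in Set.Ioc 0 T, ∫⁻ x in A, ‖evolution H ψ t x‖ₑ ^ 2 ∂ν := by
    calc ENNReal.ofReal ((a / 2) ^ 2) * ENNReal.ofReal δ
        = ∫⁻ _ in Set.Ioo t₀ (t₀ + δ), ENNReal.ofReal ((a / 2) ^ 2) := by
          rw [setLIntegral_const, Real.volume_Ioo, add_sub_cancel_left]
      _ ≤ ∫⁻ t in Set.Ioo t₀ (t₀ + δ), ∫⁻ x in A, ‖evolution H ψ t x‖ₑ ^ 2 ∂ν := by
          refine setLIntegral_mono' measurableSet_Ioo fun t ht => hlow t ?_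
          rw [Real.dist_eq, abs_of_pos (by linarith [ht.1])]
          linarith [ht.2, min_le_left ε (T - t₀)]
      _ ≤ _ := by
          refine lintegral_mono_set fun t ht => ⟨by linarith [ht.1], ?_⟩
          linarith [ht.2, min_le_right ε (T - t₀)]
  calc ENNReal.ofReal (r ^ m * (a / 2) ^ 2 * (δ / T))
      = ENNReal.ofReal (r ^ m) * (ENNReal.ofReal (1 / T) *
          (ENNReal.ofReal ((a / 2) ^ 2) * ENNReal.ofReal δ)) := by
        rw [← ENNReal.ofReal_mul (by positivity), ← ENNReal.ofReal_mul (by positivity),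
          ← ENNReal.ofReal_mul (by positivity)]
        congr 1
        ring
    _ ≤ _ := by gcongr

lemma exists_moment_bound_on_Icc {t₀ T₀ r m : ℝ} (ht₀ : 0 ≤ t₀) (hT₀ : t₀ < T₀) (hr : 0 < r)
    (hm : 0 < m) (hρ : Measurable ρ) (hcont : Continuous (evolution H ψ))
    (hne : ∫⁻ x in {x | r ≤ ρ x}, ‖evolution H ψ t₀ x‖ₑ ^ 2 ∂ν ≠ 0) (T₁ : ℝ) (hT₁ : 0 < T₁) :
    ∃ c : ℝ, 0 < c ∧ ∀ T ∈ Set.Ici T₀, T ≤ T₁ →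
      ENNReal.ofReal c ≤ averagedMoment ν ρ H ψ m T := by
  obtain ⟨c, ε, hc, hε, h⟩ := exists_moment_bound_near ht₀ hr hm hρ hcont hne
  have hδ : 0 < min ε (T₀ - t₀) := lt_min hε (by linarith)
  refine ⟨c * (min ε (T₀ - t₀) / T₁), by positivity, fun T hT hTT => ?_⟩
  have hT : T₀ ≤ T := hT
  have hT0 : 0 < T := by linarith
  refine le_trans (ENNReal.ofReal_le_ofReal ?_) (h T hT0)
  have hmin : min ε (T₀ - t₀) ≤ min ε (T - t₀) := by gcongr
  have hmin0 : 0 ≤ min ε (T - t₀) := hδ.le.trans hmin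
  gcongr

/-- With mass off the origin at time `0` itself, the favourable fraction `min ε T / T` of the time
interval stays bounded below as `T → 0`. -/
lemma exists_moment_bound_on_Ioc {r m : ℝ} (hr : 0 < r)
    (hm : 0 < m) (hρ : Measurable ρ) (hcont : Continuous (evolution H ψ))
    (hne : ∫⁻ x in {x | r ≤ ρ x}, ‖evolution H ψ 0 x‖ₑ ^ 2 ∂ν ≠ 0) (T₁ : ℝ) (hT₁ : 0 < T₁) :
    ∃ c : ℝ, 0 < c ∧ ∀ T ∈ Set.Ioi 0, T ≤ T₁ →
      ENNReal.ofReal c ≤ averagedMoment ν ρ H ψ m T := by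
  obtain ⟨c, ε, hc, hε, h⟩ := exists_moment_bound_near le_rfl hr hm hρ hcont hne
  refine ⟨c * min (ε / T₁) 1, by positivity, fun T hT hTT => ?_⟩
  have hT0 : 0 < T := hT
  refine le_trans (ENNReal.ofReal_le_ofReal ?_) (h T hT0)
  gcongr
  rw [sub_zero, le_div_iff₀ hT0, le_min_iff]
  constructor
  · calc min (ε / T₁) 1 * T ≤ ε / T₁ * T₁ := by
          gcongr
          exact min_le_left _ _
      _ = ε := by field_simp
  · calc min (ε / T₁) 1 * T ≤ 1 * T := by
          gcongr
          exact min_le_right _ _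
      _ = T := one_mul T

variable [SFinite ν]

/-- For `α > 0` the moments grow like `T^{mα/γ}` for large times. -/
lemma exists_moment_bound_large (hρ : Measurable ρ) (hH : IsSymmetricMaximal H)
    (hu : AreGeneralizedEigenfunctions ν ρ H ψ u) {α γ : ℝ} (hα0 : 0 < α) (hα1 : α ≤ 1)
    (hγ : 0 < γ) {S : Set ℝ} (hS : MeasurableSet S) (hpos : 0 < spectralMeasure H ψ S)
    (hcont : IsAlphaContinuous α ((spectralMeasure H ψ).restrict S))
    (hgrowth : ∀ E ∈ S, HasGrowth ν ρ γ (fun x => u x E)) {m : ℝ} (hm : 0 < m) :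
    ∃ C T₁ : ℝ, 0 < C ∧ 0 < T₁ ∧ ∀ T, T₁ ≤ T →
      ENNReal.ofReal (C * T ^ (m * α / γ)) ≤ averagedMoment ν ρ H ψ m T := by
  obtain ⟨s, κ, D, N, M, hs, hκ, hD, -, hM, hbound⟩ :=
    exists_escape_bound hρ hH hu hα0.le hα1 hS hpos hcont hgrowth
  -- With `R^γ = δ T^α` the error term is at most `κ D 2^γ δ`, free of `T`; `δ` makes it at most
  -- `s/2`. The `+ 1` covers a vanishing `κ D`.
  obtain ⟨δ, hδ, hδs⟩ : ∃ δ : ℝ, 0 < δ ∧ κ * (D * (2 ^ γ * δ)) ≤ s / 2 := by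
    refine ⟨s / 2 / (κ * D * 2 ^ γ + 1), by positivity, ?_⟩
    have h0 : 0 < κ * D * 2 ^ γ + 1 := by positivity
    calc κ * (D * (2 ^ γ * (s / 2 / (κ * D * 2 ^ γ + 1))))
        = s / 2 * ((κ * D * 2 ^ γ) / (κ * D * 2 ^ γ + 1)) := by ring
      _ ≤ s / 2 * 1 := by
          gcongr
          rw [div_le_one h0]
          linarith
      _ = s / 2 := mul_one _
  set L : ℝ := max N 1 with hL
  have hL1 : 1 ≤ L := le_max_right _ _
  -- The threshold on `T` is equivalent to `R ≥ L`: then `⌈R⌉₊ ≥ N`, where the growth bound is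
  -- valid, and `⌈R⌉₊ ≤ 2R`, which is the source of `2^γ`. The constant comes from `R^m = δ^{m/γ}
  -- T^{mα/γ}`.
  refine ⟨s / 2 * δ ^ (m / γ), (L ^ γ / δ) ^ α⁻¹, by positivity, by positivity, fun T hT => ?_⟩
  have hT0 : 0 < T := lt_of_lt_of_le (by positivity) hT
  set R : ℝ := (δ * T ^ α) ^ γ⁻¹ with hR
  have hR0 : 0 < R := by positivity
  have hRγ : R ^ γ = δ * T ^ α := Real.rpow_inv_rpow (by positivity) hγ.ne'
  have hLR : L ≤ R := by
    rw [hR, Real.le_rpow_inv_iff_of_pos (by positivity) (by positivity) hγ]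
    rw [Real.rpow_inv_le_iff_of_pos (by positivity) hT0.le hα0, div_le_iff₀ hδ] at hT
    linarith
  have hMR : M {x | ρ x < R} ≤ ENNReal.ofReal (D * (2 ^ γ * (δ * T ^ α))) := by
    have hceil : N ≤ ⌈R⌉₊ := Nat.cast_le.1 ((le_max_left _ _).trans (hLR.trans (Nat.le_ceil R)))
    have h1 : M {x | ρ x < R} ≤ M {x | ρ x < (⌈R⌉₊ : ℕ)} :=
      measure_mono fun x hx => lt_of_lt_of_le hx (Nat.le_ceil R)
    refine (h1.trans (hM _ hceil)).trans (ENNReal.ofReal_le_ofReal ?_)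
    rw [← hRγ, ← Real.mul_rpow (by norm_num) hR0.le]
    have : (⌈R⌉₊ : ℝ) ≤ 2 * R := by
      have := (Nat.ceil_lt_add_one hR0.le).le
      linarith
    gcongr
  have herr : ENNReal.ofReal (κ * T ^ (-α)) * M {x | ρ x < R} ≤ ENNReal.ofReal (s / 2) := by
    refine (mul_le_mul_right hMR _).trans ?_
    rw [← ENNReal.ofReal_mul (by positivity)]
    refine ENNReal.ofReal_le_ofReal (le_trans (le_of_eq ?_) hδs)
    rw [Real.rpow_neg hT0.le]
    have : T ^ α ≠ 0 := (Real.rpow_pos_of_pos hT0 α).ne'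
    field_simp
  have hmass : ENNReal.ofReal (s / 2) ≤ ENNReal.ofReal (1 / T) *
      (∫⁻ t in Set.Ioc 0 T, ∫⁻ x in {x | R ≤ ρ x}, ‖evolution H ψ t x‖ₑ ^ 2 ∂ν) := by
    exact half_le_of_le_add_half hs.le ((hbound T R hT0).trans (add_le_add_right herr _))
  refine le_trans ?_ (ofReal_rpow_mul_average_le hρ hm hR0.le T)
  refine le_trans (le_of_eq ?_) (mul_le_mul_right hmass _)
  rw [← ENNReal.ofReal_mul (by positivity)]
  congr 1
  have : R ^ m = δ ^ (m / γ) * T ^ (m * α / γ) := by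
    rw [hR, ← Real.rpow_mul (by positivity), Real.mul_rpow hδ.le (by positivity),
      ← Real.rpow_mul hT0.le]
    congr 2
    · field_simp
    · field_simp
  rw [this]
  ring

/-- For `α = 0` the moments are bounded below if there is no mass at the origin. -/
lemma exists_moment_bound_of_null (hρ : Measurable ρ) (hH : IsSymmetricMaximal H)
    (hu : AreGeneralizedEigenfunctions ν ρ H ψ u) {γ : ℝ}
    {S : Set ℝ} (hS : MeasurableSet S) (hpos : 0 < spectralMeasure H ψ S)
    (hcont : IsAlphaContinuous 0 ((spectralMeasure H ψ).restrict S))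
    (hgrowth : ∀ E ∈ S, HasGrowth ν ρ γ (fun x => u x E)) (hnull : ν {x | ρ x ≤ 0} = 0)
    {m : ℝ} (hm : 0 < m) :
    ∃ C : ℝ, 0 < C ∧ ∀ T, 0 < T → ENNReal.ofReal C ≤ averagedMoment ν ρ H ψ m T := by
  obtain ⟨s, κ, D, N, M, hs, hκ, hD, hMν, hM, hbound⟩ :=
    exists_escape_bound hρ hH hu le_rfl zero_le_one hS hpos hcont hgrowth
  -- For `α = 0` the error does not decay in `T`, so the ball is shrunk instead: `M ≪ ν` gives the
  -- origin no mass, and the masses of the shrinking balls tend to zero.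
  have hlim : Tendsto (fun n : ℕ => ENNReal.ofReal κ * M {x | ρ x < 1 / ((n : ℝ) + 1)}) atTop
      (𝓝 0) := by
    have hinter : ⋂ n : ℕ, {x | ρ x < 1 / ((n : ℝ) + 1)} = {x | ρ x ≤ 0} := by
      ext x
      simp only [Set.mem_iInter, Set.mem_ofPred_eq]
      constructor
      · intro h
        by_contra! hx
        obtain ⟨n, hn⟩ := exists_nat_one_div_lt hx
        exact lt_asymm hn (h n)
      · intro h n
        exact h.trans_lt (by positivity)
    have h1 := tendsto_measure_iInter_atTop (μ := M)
      (s := fun n : ℕ => {x | ρ x < 1 / ((n : ℝ) + 1)})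
      (fun n => (measurableSet_lt hρ measurable_const).nullMeasurableSet)
      (fun n k hnk x (hx : ρ x < 1 / ((k : ℝ) + 1)) =>
        show ρ x < 1 / ((n : ℝ) + 1) from lt_of_lt_of_le hx (Nat.one_div_le_one_div hnk))
      ⟨0, ne_top_of_le_ne_top ENNReal.ofReal_ne_top
        ((measure_mono fun x hx => ?_).trans (hM (max N 1) (le_max_left _ _)))⟩
    · rw [hinter, hMν hnull] at h1
      simpa using ENNReal.Tendsto.const_mul h1 (Or.inr ENNReal.ofReal_ne_top)
    · have h2 : (1 : ℝ) ≤ (max N 1 : ℕ) := by exact_mod_cast le_max_right _ _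
      simp only [Set.mem_ofPred_eq, CharP.cast_eq_zero, zero_add, div_one] at hx ⊢
      linarith
  obtain ⟨n, hn⟩ := (hlim.eventually_le_const
    (ENNReal.ofReal_pos.2 (half_pos hs))).exists
  set R : ℝ := 1 / ((n : ℝ) + 1) with hR
  have hR0 : 0 < R := by positivity
  refine ⟨R ^ m * (s / 2), by positivity, fun T hT => ?_⟩
  have hmass : ENNReal.ofReal (s / 2) ≤ ENNReal.ofReal (1 / T) *
      (∫⁻ t in Set.Ioc 0 T, ∫⁻ x in {x | R ≤ ρ x}, ‖evolution H ψ t x‖ₑ ^ 2 ∂ν) := by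
    have h1 := hbound T R hT
    rw [neg_zero, Real.rpow_zero, mul_one] at h1
    exact half_le_of_le_add_half hs.le (h1.trans (add_le_add_right hn _))
  refine le_trans ?_ (ofReal_rpow_mul_average_le hρ hm hR0.le T)
  rw [ENNReal.ofReal_mul (by positivity)]
  gcongr

end Moments

/-! ### Hopping: a state cannot stay at one site -/

section Hopping

variable {𝓗 : Type*} [NormedAddCommGroup 𝓗] [InnerProductSpace ℂ 𝓗]
  {H : 𝓗 →ₗ.[ℂ] 𝓗} {ψ : 𝓗} {φ : ℝ → 𝓗}

/-- If `H` has matrix element `1` between the unit vectors `e` and `e'`, then no solution of the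
Schrödinger equation stays close to the line spanned by `e`. -/
lemma IsSchrodingerSolution.hopping_bound (hφ : IsSchrodingerSolution H ψ φ) {e e' : H.domain}
    (he : ‖(e : 𝓗)‖ = 1) (he' : ‖(e' : 𝓗)‖ = 1) (horth : ⟪(e' : 𝓗), (e : 𝓗)⟫_ℂ = 0)
    (hhop : ⟪H e', (e : 𝓗)⟫_ℂ = 1) {M : ℝ} (hM : ∀ t, ‖φ t‖ = M) :
    ∃ K : ℝ, 0 < K ∧ ∀ T : ℝ, 0 ≤ T → M ^ 2 / 2 * T ≤
      K * (∫ t in (0 : ℝ)..T, ‖φ t - ⟪(e : 𝓗), φ t⟫_ℂ • (e : 𝓗)‖ ^ 2) +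
        M * ‖φ 0 - ⟪(e : 𝓗), φ 0⟫_ℂ • (e : 𝓗)‖ + M * ‖φ T - ⟪(e : 𝓗), φ T⟫_ℂ • (e : 𝓗)‖ := by
  set a : ℝ → ℂ := fun t => ⟪(e' : 𝓗), φ t⟫_ℂ with ha
  set b : ℝ → ℂ := fun t => ⟪(e : 𝓗), φ t⟫_ℂ with hb
  set w : ℝ → 𝓗 := fun t => φ t - b t • (e : 𝓗) with hw
  set q : ℝ → ℝ := fun t => ‖w t‖ with hq
  set L : ℝ := ‖H e‖ + ‖H e'‖ with hL
  -- The `1` comes from `‖b‖² = M² - q²`, the `L²/2` from `M L q ≤ M²/2 + (L²/2) q²`.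
  set K : ℝ := 1 + L ^ 2 / 2 with hK
  have hM0 : 0 ≤ M := by
    rw [← hM 0]
    exact norm_nonneg _
  have hL0 : 0 ≤ L := by positivity
  have hqc : Continuous q := by
    have hbc : Continuous b := continuous_const.inner hφ.1
    exact (hφ.1.sub (hbc.smul continuous_const)).norm
  have haw : ∀ t, a t = ⟪(e' : 𝓗), w t⟫_ℂ := by
    intro t
    simp [ha, hw, horth]
  have haq : ∀ t, ‖a t‖ ≤ q t := by
    intro t
    rw [haw]
    simpa [he'] using norm_inner_le_norm (𝕜 := ℂ) (e' : 𝓗) (w t)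
  have hbM : ∀ t, ‖b t‖ ≤ M := by
    intro t
    simpa [he, hM] using norm_inner_le_norm (𝕜 := ℂ) (e : 𝓗) (φ t)
  have hpyth : ∀ t, ‖b t‖ ^ 2 + q t ^ 2 = M ^ 2 := by
    intro t
    have hperp : ⟪b t • (e : 𝓗), w t⟫_ℂ = 0 := by
      have hee : ⟪(e : 𝓗), (e : 𝓗)⟫_ℂ = 1 := by
        rw [inner_self_eq_norm_sq_to_K, he]
        simp
      rw [inner_smul_left, show ⟪(e : 𝓗), w t⟫_ℂ = b t - b t * 1 by
        rw [← hee, ← inner_smul_right, ← inner_sub_right]]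
      ring
    have hsum : b t • (e : 𝓗) + w t = φ t := by simp [hw]
    have := norm_add_sq_eq_norm_sq_add_norm_sq_of_inner_eq_zero _ _ hperp
    rw [hsum, hM, norm_smul, he, mul_one] at this
    nlinarith
  have hda : ∀ t, HasDerivAt a (-Complex.I * ⟪H e', φ t⟫_ℂ) t := hφ.2.2 e'
  have hdb : ∀ t, HasDerivAt b (-Complex.I * ⟪H e, φ t⟫_ℂ) t := hφ.2.2 e
  have hHe' : ∀ t, ⟪H e', φ t⟫_ℂ = b t + ⟪H e', w t⟫_ℂ := by
    intro t
    simp [hw, hhop]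
  -- A current between the two sites. Since `a' = -i (b + ⟪H e', w⟫)`, the derivative of `h`
  -- contains `-‖b‖²`, so `h` falls at rate about `M²/2` while `q` is small. But `|h| ≤ M q`,
  -- because `e' ⟂ e` makes `a` a component of `w`; hence `q` cannot stay small.
  set h : ℝ → ℝ := fun t => (starRingEnd ℂ (b t) * a t).im with hh
  have hdh : ∀ t, ∃ h', HasDerivAt h h' t ∧ h' ≤ -(M ^ 2 / 2) + K * q t ^ 2 := by
    intro t
    have h1 : HasDerivAt (fun s => starRingEnd ℂ (b s))
        (starRingEnd ℂ (-Complex.I * ⟪H e, φ t⟫_ℂ)) t := (hdb t).star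
    have h2 := h1.mul (hda t)
    have h3 : HasDerivAt h _ t := (Complex.imCLM.hasFDerivAt.comp_hasDerivAt t h2)
    refine ⟨_, h3, ?_⟩
    simp only [Complex.imCLM_apply, Complex.add_im]
    have e1 : (starRingEnd ℂ (-Complex.I * ⟪H e, φ t⟫_ℂ) * a t).im ≤ ‖H e‖ * M * q t := by
      refine (Complex.im_le_norm _).trans ?_
      rw [norm_mul, RCLike.norm_conj, norm_mul]
      have hin := norm_inner_le_norm (𝕜 := ℂ) (H e) (φ t)
      rw [hM] at hin
      simp only [norm_neg, Complex.norm_I, one_mul]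
      exact mul_le_mul hin (haq t) (norm_nonneg _) (by positivity)
    have e2 : (starRingEnd ℂ (b t) * (-Complex.I * ⟪H e', φ t⟫_ℂ)).im ≤
        -‖b t‖ ^ 2 + ‖H e'‖ * M * q t := by
      have e3 : starRingEnd ℂ (b t) * (-Complex.I * ⟪H e', φ t⟫_ℂ) =
          -Complex.I * ((‖b t‖ ^ 2 : ℝ) : ℂ) +
            (-Complex.I * (starRingEnd ℂ (b t) * ⟪H e', w t⟫_ℂ)) := by
        rw [hHe', Complex.ofReal_pow, ← Complex.conj_mul']
        ring
      rw [e3, Complex.add_im]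
      have e4 : (-Complex.I * ((‖b t‖ ^ 2 : ℝ) : ℂ)).im = -‖b t‖ ^ 2 := by simp [-Complex.ofReal_pow]
      rw [e4]
      gcongr
      refine (Complex.im_le_norm _).trans ?_
      rw [norm_mul, norm_mul, RCLike.norm_conj]
      simp only [norm_neg, Complex.norm_I, one_mul]
      have hin := norm_inner_le_norm (𝕜 := ℂ) (H e') (w t)
      calc ‖b t‖ * ‖⟪H e', w t⟫_ℂ‖ ≤ M * (‖H e'‖ * q t) :=
            mul_le_mul (hbM t) hin (norm_nonneg _) hM0
        _ = _ := by ring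
    have e5 : M * L * q t ≤ M ^ 2 / 2 + L ^ 2 / 2 * q t ^ 2 := by nlinarith [sq_nonneg (M - L * q t)]
    have e6 := hpyth t
    simp only [hK]
    have e7 : ‖H e‖ * M * q t + ‖H e'‖ * M * q t = M * L * q t := by
      rw [hL]
      ring
    nlinarith
  choose h' hh' hle using hdh
  refine ⟨K, by positivity, fun T hT => ?_⟩
  have hdG : ∀ t, HasDerivAt (fun t => h t - (K * (∫ s in (0 : ℝ)..t, q s ^ 2) - M ^ 2 / 2 * t))
      (h' t - (K * q t ^ 2 - M ^ 2 / 2 * 1)) t := by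
    intro t
    have hq2 : Continuous fun s => q s ^ 2 := hqc.pow 2
    have h1 := intervalIntegral.integral_hasDerivAt_right (hq2.intervalIntegrable 0 t)
      hq2.aestronglyMeasurable.stronglyMeasurableAtFilter hq2.continuousAt
    exact (hh' t).sub ((h1.const_mul K).sub ((hasDerivAt_id t).const_mul _))
  have hanti := antitone_of_deriv_nonpos (fun t => (hdG t).differentiableAt) (fun t => by
    rw [(hdG t).deriv]
    linarith [hle t])
  have hfin := hanti hT
  simp only [intervalIntegral.integral_same, mul_zero, sub_zero] at hfin
  have hhq : ∀ t, |h t| ≤ M * q t := by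
    intro t
    refine (Complex.abs_im_le_norm _).trans ?_
    rw [norm_mul, RCLike.norm_conj]
    exact mul_le_mul (hbM t) (haq t) (norm_nonneg _) hM0
  have h0 := (abs_le.1 (hhq 0)).2
  have h1 := (abs_le.1 (hhq T)).1
  linarith

lemma IsSchrodingerSolution.exists_average_bound (hφ : IsSchrodingerSolution H ψ φ)
    {e e' : H.domain} (he : ‖(e : 𝓗)‖ = 1) (he' : ‖(e' : 𝓗)‖ = 1)
    (horth : ⟪(e' : 𝓗), (e : 𝓗)⟫_ℂ = 0) (hhop : ⟪H e', (e : 𝓗)⟫_ℂ = 1) {M : ℝ} (hM0 : 0 < M)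
    (hM : ∀ t, ‖φ t‖ = M) {F : ℝ → ℝ≥0∞}
    (hF : ∀ t, ENNReal.ofReal (‖φ t - ⟪(e : 𝓗), φ t⟫_ℂ • (e : 𝓗)‖ ^ 2) ≤ F t) :
    ∃ c T₁ : ℝ, 0 < c ∧ 0 < T₁ ∧ ∀ T, T₁ ≤ T →
      ENNReal.ofReal c ≤ ENNReal.ofReal (1 / T) * ∫⁻ t in Set.Ioc 0 T, F t := by
  obtain ⟨K, hK, h⟩ := hφ.hopping_bound he he' horth hhop hM
  set q : ℝ → ℝ := fun t => ‖φ t - ⟪(e : 𝓗), φ t⟫_ℂ • (e : 𝓗)‖ with hq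
  have hqc : Continuous q :=
    (hφ.1.sub ((continuous_const.inner hφ.1).smul continuous_const)).norm
  have hq2 : Continuous fun t => q t ^ 2 := hqc.pow 2
  have hqM : ∀ t, q t ≤ 2 * M := by
    intro t
    have h1 : ‖⟪(e : 𝓗), φ t⟫_ℂ‖ ≤ M := by
      simpa [he, hM] using norm_inner_le_norm (𝕜 := ℂ) (e : 𝓗) (φ t)
    refine (norm_sub_le _ _).trans ?_
    rw [norm_smul, he, mul_one, hM]
    linarith
  -- As `q ≤ 2M`, the boundary terms total at most `4 M²`, which for `T ≥ 16` is at most half of `M²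
  -- T / 2`.
  refine ⟨M ^ 2 / (4 * K), 16, by positivity, by norm_num, fun T hT => ?_⟩
  have hT0 : 0 < T := by linarith
  have hint : M ^ 2 / (4 * K) * T ≤ ∫ t in (0 : ℝ)..T, q t ^ 2 := by
    rw [div_mul_eq_mul_div, div_le_iff₀ (by positivity)]
    have h0 := mul_le_mul_of_nonneg_left (hqM 0) hM0.le
    have h1 := mul_le_mul_of_nonneg_left (hqM T) hM0.le
    have h2 := h T hT0.le
    nlinarith [mul_le_mul_of_nonneg_left hT (sq_nonneg M)]
  calc ENNReal.ofReal (M ^ 2 / (4 * K))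
      = ENNReal.ofReal (1 / T) * ENNReal.ofReal (M ^ 2 / (4 * K) * T) := by
        rw [← ENNReal.ofReal_mul (by positivity)]
        congr 1
        field_simp
    _ ≤ ENNReal.ofReal (1 / T) * ENNReal.ofReal (∫ t in (0 : ℝ)..T, q t ^ 2) := by gcongr
    _ = ENNReal.ofReal (1 / T) * ∫⁻ t in Set.Ioc 0 T, ENNReal.ofReal (q t ^ 2) := by
        rw [intervalIntegral.integral_of_le hT0.le, ofReal_integral_eq_lintegral_ofReal
          ((hq2.integrableOn_Icc (a := 0) (b := T)).mono_set Set.Ioc_subset_Icc_self)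
          (Eventually.of_forall fun t => sq_nonneg _)]
    _ ≤ _ := by
        gcongr with t
        exact hF t

/-- If `q` vanished on `[0, T₀)`, `hopping_bound` at `T₀ / 2` would bound a positive number by zero.
-/
lemma IsSchrodingerSolution.exists_ne (hφ : IsSchrodingerSolution H ψ φ)
    {e e' : H.domain} (he : ‖(e : 𝓗)‖ = 1) (he' : ‖(e' : 𝓗)‖ = 1)
    (horth : ⟪(e' : 𝓗), (e : 𝓗)⟫_ℂ = 0) (hhop : ⟪H e', (e : 𝓗)⟫_ℂ = 1) {M : ℝ} (hM0 : 0 < M)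
    (hM : ∀ t, ‖φ t‖ = M) {T₀ : ℝ} (hT₀ : 0 < T₀) :
    ∃ t, 0 ≤ t ∧ t < T₀ ∧ 0 < ‖φ t - ⟪(e : 𝓗), φ t⟫_ℂ • (e : 𝓗)‖ := by
  by_contra! hcon
  obtain ⟨K, hK, h⟩ := hφ.hopping_bound he he' horth hhop hM
  have hz : ∀ t, 0 ≤ t → t < T₀ → ‖φ t - ⟪(e : 𝓗), φ t⟫_ℂ • (e : 𝓗)‖ = 0 := fun t h0 h1 =>
    le_antisymm (hcon t h0 h1) (norm_nonneg _)
  have h1 := h (T₀ / 2) (by positivity)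
  rw [hz 0 le_rfl hT₀, hz (T₀ / 2) (by positivity) (by linarith),
    intervalIntegral.integral_congr (g := fun _ => 0) (fun t ht => by
      rw [Set.uIcc_of_le (by positivity)] at ht
      simp only
      rw [hz t ht.1 (by linarith [ht.2])]
      norm_num)] at h1
  simp only [intervalIntegral.integral_zero, mul_zero, add_zero] at h1
  have : 0 < M ^ 2 / 2 * (T₀ / 2) := by positivity
  linarith

end Hopping

/-! ### Discrete Schrödinger operators are self-adjoint -/

section Discrete

variable {d : ℕ} {Ω : Set (Fin d → ℤ)} {v : Ω → ℝ}

lemma mem_neighbors_comm {n k : Ω} : k ∈ (finite_neighbors Ω n).toFinset ↔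
    n ∈ (finite_neighbors Ω k).toFinset := by
  simp only [Set.Finite.mem_toFinset, Set.mem_ofPred_eq]
  exact (latticeGraph d).adj_comm _ _

lemma card_neighbors_le (n : Ω) :
    (finite_neighbors Ω n).toFinset.card ≤ (Finset.Icc (-1 : Fin d → ℤ) 1).card := by
  refine Finset.card_le_card_of_injOn (fun k : Ω => (k : Fin d → ℤ) - (n : Fin d → ℤ)) ?_ ?_
  · intro k hk
    have hk' : latticeNorm ((n : Fin d → ℤ) - (k : Fin d → ℤ)) = 1 := by
      have hadj : (latticeGraph d).Adj n k := by simpa using hk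
      exact hadj
    have hsum : ∑ i, (((n : Fin d → ℤ) - (k : Fin d → ℤ)) i : ℝ) ^ 2 = 1 := by
      unfold latticeNorm at hk'
      simpa using hk'
    have hi : ∀ i, -1 ≤ (k : Fin d → ℤ) i - (n : Fin d → ℤ) i ∧
        (k : Fin d → ℤ) i - (n : Fin d → ℤ) i ≤ 1 := by
      intro i
      have h1 : (((n : Fin d → ℤ) - (k : Fin d → ℤ)) i : ℝ) ^ 2 ≤ 1 := by
        rw [← hsum]
        exact Finset.single_le_sum (f := fun i => (((n : Fin d → ℤ) - (k : Fin d → ℤ)) i : ℝ) ^ 2)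
          (fun j _ => sq_nonneg _) (Finset.mem_univ i)
      have h2 : (((n : Fin d → ℤ) - (k : Fin d → ℤ)) i) ^ 2 ≤ 1 := by exact_mod_cast h1
      simp only [Pi.sub_apply] at h2
      constructor <;> nlinarith
    simp only [Finset.coe_Icc, Set.mem_Icc, Pi.le_def, Pi.sub_apply, Pi.neg_apply, Pi.one_apply]
    exact ⟨fun i => (hi i).1, fun i => (hi i).2⟩
  · intro k _ l _ hkl
    exact Subtype.ext (sub_left_injective hkl)

lemma discreteExpr_eq_sum (f : Ω → ℂ) (n : Ω) :
    discreteExpr Ω v f n = ∑ k ∈ (finite_neighbors Ω n).toFinset, f k + (v n : ℂ) * f n := by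
  rw [discreteExpr, finsum_mem_eq_finite_toFinset_sum]

/-- The vector `δ_n`. -/
def siteVec (n : Ω) : Lp ℂ 2 (Measure.count : Measure Ω) :=
  indicatorConstLp 2 (MeasurableSet.singleton n) (by simp) 1

lemma siteVec_apply (n k : Ω) : siteVec n k = if k = n then 1 else 0 := by
  have h := Measure.ae_count_iff.1 (indicatorConstLp_coeFn (p := 2) (c := (1 : ℂ))
    (hs := MeasurableSet.singleton n) (hμs := by simp) (μ := (Measure.count : Measure Ω))) k
  rw [siteVec, h]
  simp [Set.indicator]

lemma inner_siteVec (n : Ω) (f : Lp ℂ 2 (Measure.count : Measure Ω)) : ⟪siteVec n, f⟫_ℂ = f n := by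
  rw [siteVec, L2.inner_indicatorConstLp_one]
  simp

lemma norm_siteVec (n : Ω) : ‖siteVec n‖ = 1 := by
  simp [siteVec, norm_indicatorConstLp]

lemma discreteExpr_siteVec (n : Ω) : discreteExpr Ω v (siteVec n) =
    ⇑(∑ k ∈ (finite_neighbors Ω n).toFinset, siteVec k + (v n : ℂ) • siteVec n) := by
  funext j
  have hsum : ∀ s : Finset Ω, (⇑(∑ k ∈ s, siteVec k : Lp ℂ 2 (Measure.count : Measure Ω)) : Ω → ℂ) j
      = ∑ k ∈ s, siteVec k j := by
    classical
    intro s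
    induction s using Finset.induction_on with
    | empty => simpa using Measure.ae_count_iff.1 (Lp.coeFn_zero ℂ 2 (Measure.count : Measure Ω)) j
    | insert a s ha ih => rw [Finset.sum_insert ha, Finset.sum_insert ha, coeFn_add_count,
        Pi.add_apply, ih]
  rw [discreteExpr_eq_sum, coeFn_add_count, Pi.add_apply, hsum, coeFn_smul_count, Pi.smul_apply,
    smul_eq_mul]
  simp only [siteVec_apply]
  congr 1
  · rw [Finset.sum_ite_eq', Finset.sum_ite_eq]
    simp only [mem_neighbors_comm]
  · by_cases hj : j = n
    · rw [hj]
    · simp [hj]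

lemma siteVec_mem_domain (n : Ω) : siteVec n ∈ (discreteSchrodinger Ω v).domain := by
  change MemLp (discreteExpr Ω v (siteVec n)) 2 Measure.count
  rw [discreteExpr_siteVec]
  exact Lp.memLp _

lemma coeFn_discreteSchrodinger (f : (discreteSchrodinger Ω v).domain) (n : Ω) :
    discreteSchrodinger Ω v f n = discreteExpr Ω v (f : Lp ℂ 2 (Measure.count : Measure Ω)) n :=
  Measure.ae_count_iff.1 (MemLp.coeFn_toLp f.2) n

lemma inner_discreteSchrodinger_siteVec (n : Ω) (g : Lp ℂ 2 (Measure.count : Measure Ω)) :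
    ⟪discreteSchrodinger Ω v ⟨siteVec n, siteVec_mem_domain n⟩, g⟫_ℂ = discreteExpr Ω v g n := by
  have h : discreteSchrodinger Ω v ⟨siteVec n, siteVec_mem_domain n⟩ =
      ∑ k ∈ (finite_neighbors Ω n).toFinset, siteVec k + (v n : ℂ) • siteVec n := by
    refine Lp.ext (Eventually.of_forall fun k => ?_)
    rw [coeFn_discreteSchrodinger, ← discreteExpr_siteVec]
  rw [h, inner_add_left, sum_inner, inner_smul_left, Complex.conj_ofReal, discreteExpr_eq_sum]
  simp only [inner_siteVec]

lemma summable_norm_sq (f : Lp ℂ 2 (Measure.count : Measure Ω)) :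
    Summable fun n => ‖f n‖ ^ 2 :=
  (integrable_count_iff.1 ((Lp.memLp f).integrable_norm_pow two_ne_zero)).of_norm

lemma summable_inner (f g : Lp ℂ 2 (Measure.count : Measure Ω)) :
    Summable fun n => g n * starRingEnd ℂ (f n) := by
  have := integrable_count_iff.1 (L2.integrable_inner (𝕜 := ℂ) f g) |>.of_norm
  simpa only [RCLike.inner_apply] using this

lemma inner_eq_tsum (f g : Lp ℂ 2 (Measure.count : Measure Ω)) :
    ⟪f, g⟫_ℂ = ∑' n, g n * starRingEnd ℂ (f n) := by
  rw [L2.inner_def, integral_countable (L2.integrable_inner (𝕜 := ℂ) f g)]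
  simp [Measure.real]

/-- Each term is dominated by `‖g n‖² + ‖f k‖²`, and the vertex degrees are uniformly bounded.
Absolute convergence justifies interchanging the sums in the proof of symmetry. -/
lemma summable_hopping (f g : Lp ℂ 2 (Measure.count : Measure Ω)) :
    Summable fun p : Ω × Ω => if p.2 ∈ (finite_neighbors Ω p.1).toFinset then
      g p.1 * starRingEnd ℂ (f p.2) else 0 := by
  have key : ∀ h : Lp ℂ 2 (Measure.count : Measure Ω), Summable fun p : Ω × Ω =>
      if p.2 ∈ (finite_neighbors Ω p.1).toFinset then ‖h p.1‖ ^ 2 else 0 := by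
    intro h
    have htsum : ∀ n : Ω, HasSum (fun k => if k ∈ (finite_neighbors Ω n).toFinset then
        ‖h n‖ ^ 2 else 0) ((finite_neighbors Ω n).toFinset.card * ‖h n‖ ^ 2) := by
      intro n
      have := hasSum_sum_of_ne_finset_zero (L := .unconditional Ω)
        (f := fun k => if k ∈ (finite_neighbors Ω n).toFinset then ‖h n‖ ^ 2 else 0)
        (s := (finite_neighbors Ω n).toFinset) (fun k hk => if_neg hk)
      rwa [Finset.sum_ite_mem, Finset.inter_self, Finset.sum_const, nsmul_eq_mul] at this
    refine (summable_prod_of_nonneg fun p => ?_).2 ⟨fun n => (htsum n).summable, ?_⟩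
    · simp only [Pi.zero_apply]
      split_ifs <;> positivity
    · simp only [(htsum _).tsum_eq]
      refine Summable.of_nonneg_of_le (fun n => by positivity) (fun n => ?_)
        ((summable_norm_sq h).mul_left ((Finset.Icc (-1 : Fin d → ℤ) 1).card : ℝ))
      have : ((finite_neighbors Ω n).toFinset.card : ℝ) ≤ (Finset.Icc (-1 : Fin d → ℤ) 1).card := by
        exact_mod_cast card_neighbors_le n
      gcongr
  refine Summable.of_norm_bounded ((key g).add (key f).prod_symm) fun p => ?_
  simp only [Prod.fst_swap, Prod.snd_swap]
  by_cases h : p.2 ∈ (finite_neighbors Ω p.1).toFinset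
  · rw [if_pos h, if_pos h, if_pos (mem_neighbors_comm.1 h), norm_mul, RCLike.norm_conj]
    nlinarith [sq_nonneg (‖g p.1‖ - ‖f p.2‖), sq_nonneg (‖g p.1‖ + ‖f p.2‖)]
  · rw [if_neg h, if_neg h, if_neg fun h' => h (mem_neighbors_comm.1 h')]
    simp

/-- Symmetry follows by interchanging the hopping sums over the symmetric adjacency relation.
Maximality follows by testing the adjoint relation on the vectors `siteVec n`, which recovers the
difference expression site by site. -/
lemma isSymmetricMaximal_discreteSchrodinger : IsSymmetricMaximal (discreteSchrodinger Ω v) := by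
  constructor
  · intro f g
    set F : Lp ℂ 2 (Measure.count : Measure Ω) := f.1 with hF
    set G : Lp ℂ 2 (Measure.count : Measure Ω) := g.1 with hG
    have hA := summable_hopping F G
    set A : Ω × Ω → ℂ := fun p => if p.2 ∈ (finite_neighbors Ω p.1).toFinset then
      G p.1 * starRingEnd ℂ (F p.2) else 0 with hAdef
    set V : Ω → ℂ := fun n => (v n : ℂ) * (G n * starRingEnd ℂ (F n)) with hV
    have hfin : ∀ (s : Finset Ω) (c : Ω → ℂ), ∑' k, (if k ∈ s then c k else 0) = ∑ k ∈ s, c k := by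
      intro s c
      rw [tsum_eq_sum (s := s) (fun k hk => if_neg hk), Finset.sum_ite_mem, Finset.inter_self]
    have e1 : ∀ n, G n * starRingEnd ℂ (discreteSchrodinger Ω v f n) = ∑' k, A (n, k) + V n := by
      intro n
      have h1 : ∑' k, A (n, k) =
          ∑ k ∈ (finite_neighbors Ω n).toFinset, G n * starRingEnd ℂ (F k) := by
        rw [← hfin]
      rw [h1, coeFn_discreteSchrodinger, discreteExpr_eq_sum, map_add, map_sum, map_mul,
        Complex.conj_ofReal, mul_add, Finset.mul_sum]
      simp only [hV]
      ring
    have e2 : ∀ n, discreteSchrodinger Ω v g n * starRingEnd ℂ (F n) = ∑' k, A (k, n) + V n := by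
      intro n
      have h1 : ∑' k, A (k, n) =
          ∑ k ∈ (finite_neighbors Ω n).toFinset, G k * starRingEnd ℂ (F n) := by
        rw [← hfin]
        refine tsum_congr fun k => ?_
        simp only [hAdef]
        by_cases h : n ∈ (finite_neighbors Ω k).toFinset
        · rw [if_pos h, if_pos (mem_neighbors_comm.1 h)]
        · rw [if_neg h, if_neg fun h' => h (mem_neighbors_comm.1 h')]
      rw [h1, coeFn_discreteSchrodinger, discreteExpr_eq_sum, add_mul, Finset.sum_mul]
      simp only [hV]
      ring
    have hs1 : Summable fun n => ∑' k, A (n, k) := hA.prod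
    have hs2 : Summable fun n => ∑' k, A (k, n) := hA.prod_symm.prod
    -- The potential may be unbounded; its terms are summable as the difference of a convergent
    -- inner product and the convergent hopping sum.
    have hVs : Summable V := by
      have := (summable_inner (discreteSchrodinger Ω v f) G).sub hs1
      refine this.congr fun n => ?_
      rw [e1]
      ring
    rw [inner_eq_tsum, inner_eq_tsum]
    simp only [e1, e2]
    rw [hs1.tsum_add hVs, hs2.tsum_add hVs]
    congr 1
    exact (Summable.tsum_comm (f := fun k n => A (k, n)) hA).symm
  · intro g h hgh
    have hexpr : discreteExpr Ω v g = ⇑h := by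
      funext n
      have := hgh ⟨siteVec n, siteVec_mem_domain n⟩
      rwa [inner_discreteSchrodinger_siteVec, inner_siteVec] at this
    have hmem : g ∈ (discreteSchrodinger Ω v).domain := by
      change MemLp (discreteExpr Ω v g) 2 Measure.count
      rw [hexpr]
      exact Lp.memLp h
    refine ⟨hmem, Lp.ext (Eventually.of_forall fun n => ?_)⟩
    rw [coeFn_discreteSchrodinger, hexpr]

lemma one_le_latticeNorm {n : Fin d → ℤ} (hn : n ≠ 0) : 1 ≤ latticeNorm n := by
  obtain ⟨i, hi⟩ := Function.ne_iff.1 hn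
  rw [latticeNorm, Real.one_le_sqrt]
  have h1 : (1 : ℝ) ≤ (n i : ℝ) ^ 2 := by
    have h2 : 0 < n i ^ 2 := sq_pos_of_ne_zero hi
    exact_mod_cast h2
  exact h1.trans (Finset.single_le_sum (f := fun i => (n i : ℝ) ^ 2) (fun j _ => sq_nonneg _)
    (Finset.mem_univ i))

/-- The part of `f` off the site `n₀` at the origin is carried by `{1 ≤ |n|}`. -/
lemma ofReal_norm_sub_siteVec_sq_le {n₀ : Ω} (h₀ : (n₀ : Fin d → ℤ) = 0)
    (f : Lp ℂ 2 (Measure.count : Measure Ω)) :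
    ENNReal.ofReal (‖f - ⟪siteVec n₀, f⟫_ℂ • siteVec n₀‖ ^ 2) ≤
      ∫⁻ n in {n : Ω | 1 ≤ latticeNorm n.1}, ‖f n‖ₑ ^ 2 ∂Measure.count := by
  rw [ofReal_norm_sq_eq_lintegral, ← lintegral_indicator (MeasurableSet.of_discrete)]
  refine lintegral_mono_ae ?_
  filter_upwards [Lp.coeFn_sub f (⟪siteVec n₀, f⟫_ℂ • siteVec n₀)] with n hn
  rw [hn, Pi.sub_apply, coeFn_smul_count, Pi.smul_apply, inner_siteVec, siteVec_apply]
  by_cases hn0 : n = n₀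
  · simp [hn0]
  · have h1 : 1 ≤ latticeNorm n.1 :=
      one_le_latticeNorm fun h => hn0 (Subtype.ext (h.trans h₀.symm))
    rw [Set.indicator_of_mem (by exact h1)]
    simp [hn0]

lemma exists_adj_of_infinite_connected (hinf : Ω.Infinite)
    (hconn : ((latticeGraph d).induce Ω).Connected) (n : Ω) :
    ∃ k : Ω, (latticeGraph d).Adj n k := by
  have : Nontrivial Ω := by
    have := hinf.to_subtype
    infer_instance
  obtain ⟨k, hk⟩ := hconn.preconnected.exists_adj_of_nontrivial n
  exact ⟨k, hk⟩

end Discrete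

/-! ### Escape from the origin in the discrete setting -/

section Discrete

variable {d : ℕ} {Ω : Set (Fin d → ℤ)} {v : Ω → ℝ}

/-- On an infinite connected set, every nonzero state leaves the origin. -/
lemma IsSchrodingerSolution.escapes_origin (hinf : Ω.Infinite)
    (hconn : ((latticeGraph d).induce Ω).Connected) {ψ : Lp ℂ 2 (Measure.count : Measure Ω)}
    {φ : ℝ → Lp ℂ 2 (Measure.count : Measure Ω)}
    (hφ : IsSchrodingerSolution (discreteSchrodinger Ω v) ψ φ) {M : ℝ} (hM0 : 0 < M)
    (hM : ∀ t, ‖φ t‖ = M) :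
    (∀ T₀ : ℝ, 0 < T₀ → ∃ t, 0 ≤ t ∧ t < T₀ ∧
      ∫⁻ n in {n : Ω | 1 ≤ latticeNorm n.1}, ‖φ t n‖ₑ ^ 2 ∂Measure.count ≠ 0) ∧
    ∃ c T₁ : ℝ, 0 < c ∧ 0 < T₁ ∧ ∀ T, T₁ ≤ T → ENNReal.ofReal c ≤ ENNReal.ofReal (1 / T) *
      ∫⁻ t in Set.Ioc 0 T,
        ∫⁻ n in {n : Ω | 1 ≤ latticeNorm n.1}, ‖φ t n‖ₑ ^ 2 ∂Measure.count := by
  -- If the origin is a site, connectedness supplies a neighbour with hopping matrix element `1`.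
  -- Otherwise every site has length at least `1` and the whole mass counts.
  by_cases h0 : (0 : Fin d → ℤ) ∈ Ω
  · set n₀ : Ω := ⟨0, h0⟩ with hn₀
    obtain ⟨k, hk⟩ := exists_adj_of_infinite_connected hinf hconn n₀
    have hkn : k ≠ n₀ := fun h => hk.ne (by rw [h])
    have horth : ⟪siteVec k, siteVec n₀⟫_ℂ = 0 := by
      rw [inner_siteVec, siteVec_apply, if_neg hkn]
    have hhop : ⟪discreteSchrodinger Ω v ⟨siteVec k, siteVec_mem_domain k⟩, siteVec n₀⟫_ℂ = 1 := by
      have hmem : n₀ ∈ (finite_neighbors Ω k).toFinset := by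
        simpa using hk.symm
      rw [inner_discreteSchrodinger_siteVec, discreteExpr_eq_sum]
      simp only [siteVec_apply]
      rw [Finset.sum_ite_eq', if_pos hmem, if_neg hkn, mul_zero, add_zero]
    refine ⟨fun T₀ hT₀ => ?_, ?_⟩
    · obtain ⟨t, ht0, ht, hpos⟩ := hφ.exists_ne (e := ⟨siteVec n₀, siteVec_mem_domain n₀⟩)
        (e' := ⟨siteVec k, siteVec_mem_domain k⟩) (norm_siteVec _) (norm_siteVec _) horth hhop
        hM0 hM hT₀
      refine ⟨t, ht0, ht, ((ENNReal.ofReal_pos.2 ?_).trans_le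
        (ofReal_norm_sub_siteVec_sq_le (n₀ := n₀) rfl (φ t))).ne'⟩
      exact pow_pos hpos 2
    · exact hφ.exists_average_bound (e := ⟨siteVec n₀, siteVec_mem_domain n₀⟩)
        (e' := ⟨siteVec k, siteVec_mem_domain k⟩) (norm_siteVec _) (norm_siteVec _) horth hhop
        hM0 hM fun t => ofReal_norm_sub_siteVec_sq_le (n₀ := n₀) rfl (φ t)
  · have huniv : {n : Ω | 1 ≤ latticeNorm n.1} = Set.univ :=
      Set.eq_univ_of_forall fun n => one_le_latticeNorm fun h => h0 (h ▸ n.2)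
    have hmass : ∀ t, ∫⁻ n in {n : Ω | 1 ≤ latticeNorm n.1}, ‖φ t n‖ₑ ^ 2 ∂Measure.count =
        ENNReal.ofReal (M ^ 2) := fun t => by
      rw [huniv, Measure.restrict_univ, ← ofReal_norm_sq_eq_lintegral, hM]
    have hM2 : 0 < M ^ 2 := by positivity
    refine ⟨fun T₀ hT₀ => ⟨0, le_rfl, hT₀, ?_⟩, M ^ 2, 1, hM2, one_pos, fun T hT => ?_⟩
    · rw [hmass]
      exact (ENNReal.ofReal_pos.2 hM2).ne'
    · have hT0 : 0 < T := by linarith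
      simp only [hmass]
      rw [setLIntegral_const, Real.volume_Ioc, sub_zero, mul_left_comm,
        ← ENNReal.ofReal_mul (by positivity), one_div_mul_cancel hT0.ne', ENNReal.ofReal_one, mul_one]

end Discrete

lemma exists_lintegral_ne_zero {X : Type*} [MeasurableSpace X] {ν : Measure X} {ρ : X → ℝ}
    (hρ : Measurable ρ) (hnull : ν {x | ρ x ≤ 0} = 0) {f : Lp ℂ 2 ν} (hf : f ≠ 0) :
    ∃ r : ℝ, 0 < r ∧ ∫⁻ x in {x | r ≤ ρ x}, ‖f x‖ₑ ^ 2 ∂ν ≠ 0 := by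
  by_contra! hcon
  refine hf (Lp.ext ?_)
  have h1 : ∀ n : ℕ, ∀ᵐ x ∂ν, 1 / ((n : ℝ) + 1) ≤ ρ x → f x = 0 := by
    intro n
    have h2 := hcon (1 / ((n : ℝ) + 1)) (by positivity)
    rw [lintegral_eq_zero_iff' ((Lp.aestronglyMeasurable f).restrict.enorm.pow_const 2),
      EventuallyEq, ae_restrict_iff' (measurableSet_le measurable_const hρ)] at h2
    filter_upwards [h2] with x hx hxr
    simpa using hx hxr
  filter_upwards [ae_all_iff.2 h1, measure_eq_zero_iff_ae_notMem.1 hnull,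
    Lp.coeFn_zero ℂ 2 ν] with x hx hx0 hz
  rw [hz]
  simp only [not_le] at hx0
  obtain ⟨n, hn⟩ := exists_nat_one_div_lt hx0
  exact hx n hn.le

end

/-! ### Proof of the theorem in both settings -/

theorem theorem1p2 (d : ℕ) (α γ : ℝ) (hα0 : 0 ≤ α) (hα1 : α ≤ 1) (hγ0 : 0 < γ) (hγd : γ < d) :
    -- continuous setting
    (∀ (Ω : Set (EuclideanSpace ℝ (Fin d))) (_ : IsOpen Ω)
      (V : EuclideanSpace ℝ (Fin d) → ℝ) (_ : Measurable V)
      (H : Lp ℂ 2 (volume.restrict Ω) →ₗ.[ℂ] Lp ℂ 2 (volume.restrict Ω))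
      (_ : IsDirichletSchrodinger Ω V H)
      (ψ : Lp ℂ 2 (volume.restrict Ω))
      (u : EuclideanSpace ℝ (Fin d) → ℝ → ℂ)
      (_ : AreGeneralizedEigenfunctions (volume.restrict Ω) (fun x => ‖x‖) H ψ u)
      (S : Set ℝ) (_ : MeasurableSet S) (_ : 0 < spectralMeasure H ψ S)
      (_ : IsAlphaContinuous α ((spectralMeasure H ψ).restrict S))
      (_ : ∀ E ∈ S, HasGrowth (volume.restrict Ω) (fun x => ‖x‖) γ (fun x => u x E)),
      ∀ m : ℝ, 0 < m → ∃ C : ℝ, 0 < C ∧ ∀ T : ℝ, 0 < T →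
        ENNReal.ofReal (C * T ^ (m * α / γ)) ≤
          averagedMoment (volume.restrict Ω) (fun x => ‖x‖) H ψ m T) ∧
    -- discrete setting
    (∀ (Ω : Set (Fin d → ℤ)) (_ : Ω.Infinite) (_ : ((latticeGraph d).induce Ω).Connected)
      (v : Ω → ℝ)
      (ψ : Lp ℂ 2 (Measure.count : Measure Ω))
      (u : Ω → ℝ → ℂ)
      (_ : AreGeneralizedEigenfunctions Measure.count (fun n : Ω => latticeNorm n.1)
        (discreteSchrodinger Ω v) ψ u)
      (S : Set ℝ) (_ : MeasurableSet S) (_ : 0 < spectralMeasure (discreteSchrodinger Ω v) ψ S)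
      (_ : IsAlphaContinuous α ((spectralMeasure (discreteSchrodinger Ω v) ψ).restrict S))
      (_ : ∀ E ∈ S, HasGrowth Measure.count (fun n : Ω => latticeNorm n.1) γ (fun n => u n E)),
      ∀ m : ℝ, 0 < m →
        (∀ T₀ : ℝ, 0 < T₀ → ∃ C : ℝ, 0 < C ∧ ∀ T : ℝ, T₀ ≤ T →
          ENNReal.ofReal (C * T ^ (m * α / γ)) ≤
            averagedMoment Measure.count (fun n : Ω => latticeNorm n.1)
              (discreteSchrodinger Ω v) ψ m T) ∧
        ((∃ n : Ω, n.1 ≠ 0 ∧ ψ n ≠ 0) → ∃ C : ℝ, 0 < C ∧ ∀ T : ℝ, 0 < T →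
          ENNReal.ofReal (C * T ^ (m * α / γ)) ≤
            averagedMoment Measure.count (fun n : Ω => latticeNorm n.1)
              (discreteSchrodinger Ω v) ψ m T)) := by
  -- In positive dimension the origin is a Lebesgue null set.
  have hd : 0 < d := by
    have : (0 : ℝ) < d := hγ0.trans hγd
    exact_mod_cast this
  refine ⟨?_, ?_⟩
  · intro Ω _ V _ H hH' ψ u hu S hS hpos hcont hgrowth m hm
    have hH := hH'.1.isSymmetricMaximal
    have hρ : Measurable fun x : EuclideanSpace ℝ (Fin d) => ‖x‖ := measurable_norm
    have hnull : (volume.restrict Ω) {x : EuclideanSpace ℝ (Fin d) | ‖x‖ ≤ 0} = 0 := by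
      have : Nonempty (Fin d) := ⟨⟨0, hd⟩⟩
      have hset : {x : EuclideanSpace ℝ (Fin d) | ‖x‖ ≤ 0} = {0} := by
        ext x
        simp
      rw [hset]
      exact measure_singleton 0
    obtain ⟨-, U, hU, -⟩ := id hu
    have hsol := hU.isSchrodingerSolution_evolution hH
    rcases hα0.eq_or_lt with rfl | hαpos
    · obtain ⟨C, hC, h⟩ := exists_moment_bound_of_null hρ hH hu hS hpos hcont hgrowth hnull hm
      refine ⟨C, hC, fun T hT => ?_⟩
      simpa using h T hT
    · have hne : evolution H ψ 0 ≠ 0 := by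
        intro h
        have h1 := hU.norm_evolution_sq hH 0
        have h2 : 0 < (spectralMeasure H ψ).real Set.univ :=
          ENNReal.toReal_pos (hpos.trans_le (measure_mono (Set.subset_univ S))).ne'
            (measure_ne_top _ _)
        rw [h, norm_zero] at h1
        norm_num at h1
        linarith
      obtain ⟨r, hr, hr'⟩ := exists_lintegral_ne_zero hρ hnull hne
      exact exists_bound_of_large_of_bounded (I := Set.Ioi 0) (by positivity) (fun T hT => hT)
        (exists_moment_bound_large hρ hH hu hαpos hα1 hγ0 hS hpos hcont hgrowth hm)
        (exists_moment_bound_on_Ioc hr hm hρ hsol.1 hr')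
  · intro Ω hinf hconn v ψ u hu S hS hpos hcont hgrowth m hm
    have hH : IsSymmetricMaximal (discreteSchrodinger Ω v) := isSymmetricMaximal_discreteSchrodinger
    have hρ : Measurable fun n : Ω => latticeNorm n.1 := .of_discrete
    obtain ⟨-, U, hU, -⟩ := id hu
    have hsol := hU.isSchrodingerSolution_evolution hH
    have hμ : 0 < (spectralMeasure (discreteSchrodinger Ω v) ψ).real Set.univ :=
      ENNReal.toReal_pos (hpos.trans_le (measure_mono (Set.subset_univ S))).ne'
        (measure_ne_top _ _)
    -- `hfar` gives the bound at large times when `α = 0`; `hnear` gives an instant before `T₀` with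
    -- mass off the origin, needed when `ψ` may start at the origin.
    obtain ⟨hnear, hfar⟩ := hsol.escapes_origin hinf hconn (Real.sqrt_pos.2 hμ) fun t => by
      rw [← hU.norm_evolution_sq hH t, Real.sqrt_sq (norm_nonneg _)]
    have hlarge : ∃ C T₁ : ℝ, 0 < C ∧ 0 < T₁ ∧ ∀ T, T₁ ≤ T →
        ENNReal.ofReal (C * T ^ (m * α / γ)) ≤ averagedMoment Measure.count
          (fun n : Ω => latticeNorm n.1) (discreteSchrodinger Ω v) ψ m T := by
      rcases hα0.eq_or_lt with rfl | hαpos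
      · obtain ⟨c, T₁, hc, hT₁, h⟩ := hfar
        refine ⟨c, T₁, hc, hT₁, fun T hT => ?_⟩
        have h1 := ofReal_rpow_mul_average_le (H := discreteSchrodinger Ω v) (ψ := ψ) hρ hm
          zero_le_one T
        rw [Real.one_rpow, ENNReal.ofReal_one, one_mul] at h1
        simpa using (h T hT).trans h1
      · exact exists_moment_bound_large hρ hH hu hαpos hα1 hγ0 hS hpos hcont hgrowth hm
    have hp : 0 ≤ m * α / γ := by positivity
    refine ⟨fun T₀ hT₀ => ?_, ?_⟩
    · obtain ⟨t, ht0, ht, hne⟩ := hnear T₀ hT₀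
      exact exists_bound_of_large_of_bounded (I := Set.Ici T₀) hp (fun T hT => hT₀.trans_le hT)
        hlarge (exists_moment_bound_on_Icc ht0 ht one_pos hm hρ hsol.1 hne)
    -- Here the mass off the origin is present at time `0`, so the bound extends down to `T → 0`.
    · rintro ⟨n, hn, hψn⟩
      have hne : ∫⁻ k in {k : Ω | 1 ≤ latticeNorm k.1},
          ‖evolution (discreteSchrodinger Ω v) ψ 0 k‖ₑ ^ 2 ∂Measure.count ≠ 0 := by
        rw [hsol.2.1]
        intro h
        rw [lintegral_eq_zero_iff (by fun_prop), EventuallyEq,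
          ae_restrict_iff' MeasurableSet.of_discrete, Measure.ae_count_iff] at h
        exact hψn (by simpa using h n (one_le_latticeNorm hn))
      exact exists_bound_of_large_of_bounded (I := Set.Ioi 0) hp (fun T hT => hT)
        hlarge (exists_moment_bound_on_Ioc one_pos hm hρ hsol.1 hne)
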